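/- Let $M$ be a smooth manifold of finite dimension with a Riemannian metric $g=\langle\ ,\ \rangle$ and let $\nabla$ be a smooth metric connection on $M$, i.e. $\nabla g=0$, with torsion $T^\nabla(X,Y)=\nabla_XY-\nabla_YX-[X,Y]$ (not assumed to vanish) and curvature $R^\nabla(X,Y)Z=\nabla_X\nabla_YZ-\nabla_Y\nabla_XZ-\nabla_{[X,Y]}Z$. Let $\pi:TM\to M$ be the projection, $\nabla^*$ the pull-back connection on $\pi^*TM$, and $\xi$ the canonical section of $\pi^*TM$, $\xi_u=u$. Let $V=\ker d\pi\subset TTM$, canonically identified with $\pi^*TM$, and $H=\{X\in TTM:\nabla^*_X\xi=0\}$, identified with $\pi^*TM$ by $d\pi$. Then $TTM=H\oplus V$; write $X=X^h+X^v$, where $X^v=\nabla^*_X\xi$ under $V=\pi^*TM$. We also write $\langle\ ,\ \rangle$ for the pull-back of $g$ to $H$ and to $V$, and $\nabla^*$ for the connections it induces on $H$ and on $V$. Let $\varphi_1,\varphi_2\in C^\infty(M)$, $f_1=e^{2\varphi_1}$, $f_2=e^{2\varphi_2}$ (composed with $\pi$ when used on $TM$), and for a vector $X$ tangent to $TM$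 let $X(\varphi_i)=d\varphi_i(d\pi X)$. Put $$G(X,Y)=f_1\langle X^h,Y^h\rangle+f_2\langle X^v,Y^v\rangle .$$ For vector fields $X,Y,Z$ on $TM$ define: - $D^*_XY=\nabla^*_XY^h+C_1(X^h,Y^h)+\nabla^*_XY^v+X(\varphi_2)Y^v$, where, with $\operatorname{grad}\varphi_i$ denoting the horizontal lift of the $g$-gradient of $\varphi_i$, $C_1(X,Y)=X(\varphi_1)Y+Y(\varphi_1)X-\langle X,Y\rangle\operatorname{grad}\varphi_1$ for $X,Y\in H$; - $\mathcal R^\xi(X,Y)=R^*(X,Y)\xi\in V$, where $R^*=\pi^*R^\nabla$; - $A(X,Y)=A_XY\in H$ by $f_1\langle A_XY,Z^h\rangle=\frac{f_2}{2}\bigl(\langle R^*(X^h,Z^h)\xi,Y^v\rangle+\langle R^*(Y^h,Z^h)\xi,X^v\rangle\bigr)$; - $B(X,Y)=Y(\varphi_2)X^v-\frac{f_2}{f_1}\langle X^v,Y^v\rangle\operatorname{grad}\varphi_2$; - $\tau(X,Y)=\tau_XY\in H$ by $\langle\tau_XY,Z^h\rangle=\frac12\bigl(T(Y,X,Z)+T(X,Z,Y)+T(Y,Z,X)\bigr)$,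 where $T(X,Y,Z)=\langle T^\nabla(d\pi X,d\pi Y),d\pi Z\rangle$. Then $G$ is a smooth Riemannian metric on $TM$, it has a smooth Levi-Civita connection $\nabla^G$ (torsion-free and with $\nabla^GG=0$), and this connection is given by $$\nabla^G_XY=D^*_XY-\tfrac12\mathcal R^\xi(X,Y)+A(X,Y)+B(X,Y)+\tau(X,Y)$$ for all vector fields $X,Y$ on $TM$. -/

import Mathlib

open Bundle FiberBundle
open scoped Manifold ContDiff

noncomputable section

namespace TangentConn

variable {E : Type*} [NormedAddCommGroup E] [NormedSpace ℝ E]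
  {H : Type*} [TopologicalSpace H] {I : ModelWithCorners ℝ E H}
  {M : Type*} [TopologicalSpace M] [ChartedSpace H M]

/-! ### Metric connections and Levi-Civita connections -/

section Metric

variable [IsManifold I 1 M]

/-- `D` is a metric connection for `g`:
`X (g (Y, Z)) = g (∇_X Y, Z) + g (Y, ∇_X Z)` for all tangent vectors `X` and all vector fields
`Y`, `Z` that are differentiable at the base point of `X`. -/
def IsMetricConnection (g : ContMDiffRiemannianMetric I ∞ E (TangentSpace I : M → Type _))
    (D : CovariantDerivative I E (TangentSpace I : M → Type _)) : Prop :=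
  ∀ (x : M) (Y Z : Π y : M, TangentSpace I y),
    MDifferentiableAt I I.tangent (fun y => (⟨y, Y y⟩ : TangentBundle I M)) x →
    MDifferentiableAt I I.tangent (fun y => (⟨y, Z y⟩ : TangentBundle I M)) x →
    ∀ X : TangentSpace I x,
      mvfderiv I (fun y => g.inner y (Y y) (Z y)) x X =
        g.inner x (D Y x X) (Z x) + g.inner x (Y x) (D Z x X)

/-- `D` is a Levi-Civita connection of `g`: it is torsion-free and metric. -/
def IsLeviCivita [FiniteDimensional ℝ E] [IsManifold I 2 M]
    (g : ContMDiffRiemannianMetric I ∞ E (TangentSpace I : M → Type _))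
    (D : CovariantDerivative I E (TangentSpace I : M → Type _)) : Prop :=
  D.torsion = 0 ∧ IsMetricConnection g D

/-- The vector `ℓ^♯` determined by `g (ℓ^♯, z) = ℓ z` for all `z`, for a linear form `ℓ` on the
tangent space at `x` (an arbitrary vector if `ℓ` is not linear). -/
def sharp (g : ContMDiffRiemannianMetric I ∞ E (TangentSpace I : M → Type _)) (x : M)
    (ℓ : TangentSpace I x → ℝ) : TangentSpace I x :=
  Classical.epsilon fun a => ∀ z, g.inner x a z = ℓ z

theorem inner_sharp [FiniteDimensional ℝ E]
    (g : ContMDiffRiemannianMetric I ∞ E (TangentSpace I : M → Type _)) (x : M)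
    (ℓ : TangentSpace I x →ₗ[ℝ] ℝ) (z : TangentSpace I x) :
    g.inner x (sharp g x ℓ) z = ℓ z := by
  have : FiniteDimensional ℝ (TangentSpace I x) := inferInstanceAs (FiniteDimensional ℝ E)
  let B : TangentSpace I x →ₗ[ℝ] Module.Dual ℝ (TangentSpace I x) :=
    { toFun := fun a => (g.inner x a).toLinearMap
      map_add' := fun a b => by ext; simp
      map_smul' := fun c a => by ext; simp }
  have hB : Function.Injective B := by
    rw [injective_iff_map_eq_zero]
    intro a ha
    by_contra hne
    have h1 := g.pos x a hne
    have h2 : g.inner x a a = 0 := congrArg (fun f : Module.Dual ℝ (TangentSpace I x) => f a) ha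
    exact absurd h2 h1.ne'
  have hS : Function.Surjective B :=
    (LinearMap.injective_iff_surjective_of_finrank_eq_finrank
      (Subspace.dual_finrank_eq (K := ℝ) (V := TangentSpace I x)).symm).1 hB
  obtain ⟨a, ha⟩ := hS ℓ
  have hex : ∃ a, ∀ z, g.inner x a z = ℓ z :=
    ⟨a, fun z => congrArg (fun f : Module.Dual ℝ (TangentSpace I x) => f z) ha⟩
  exact Classical.epsilon_spec hex z

/-- The gradient of `φ` with respect to `g`. -/
def grad (g : ContMDiffRiemannianMetric I ∞ E (TangentSpace I : M → Type _)) (φ : M → ℝ) (x : M) :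
    TangentSpace I x :=
  sharp g x (mvfderiv I φ x)

/-- The curvature tensor `R (a, b) c = ∇_a ∇_b c - ∇_b ∇_a c - ∇_[a, b] c`, computed on the
extensions of the vectors `a`, `b`, `c` that are constant in the preferred trivialization at `x`. -/
def curvature (D : CovariantDerivative I E (TangentSpace I : M → Type _)) (x : M)
    (a b c : TangentSpace I x) : TangentSpace I x :=
  D (fun y => D (extend E c) y (extend E b y)) x a
    - D (fun y => D (extend E c) y (extend E a y)) x b
    - D (extend E c) x (VectorField.mlieBracket I (extend E a) (extend E b) x)

end Metric

/-! ### The pull-back connection and the splitting of the second tangent bundle -/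

variable [IsManifold I ∞ M]

/-- The pull-back `f^*∇` of a connection on `M` under `f : N → M`. A section of `f^*TM` is a family
`σ w ∈ T_{f w} M`. In the trivialization of `TM` around `f w`, with local frame `(e_i)` and
`σ = ∑ σ^i (e_i ∘ f)`, the value is
`(f^*∇)_X σ = ∑ dσ^i (X) e_i + ∑ σ^i ∇_{df (X)} e_i`. -/
def pullbackConnection {E' H' N : Type*} [NormedAddCommGroup E'] [NormedSpace ℝ E']
    [TopologicalSpace H'] (J : ModelWithCorners ℝ E' H') [TopologicalSpace N] [ChartedSpace H' N]
    (D : CovariantDerivative I E (TangentSpace I : M → Type _)) (f : N → M)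
    (σ : Π w : N, TangentSpace I (f w)) (w : N) :
    TangentSpace J w →L[ℝ] TangentSpace I (f w) :=
  ((trivializationAt E (TangentSpace I : M → Type _) (f w)).symmL ℝ (f w)).comp
      (mvfderiv J (fun w' : N =>
        ((trivializationAt E (TangentSpace I : M → Type _) (f w)) ⟨f w', σ w'⟩).2) w)
    + (D (extend E (σ w)) (f w)).comp (mfderiv J I f w)

/-- The differential `dπ` of the bundle projection `π : TM → M` at `u`. -/
def dproj (u : TangentBundle I M) : TangentSpace I.tangent u →L[ℝ] TangentSpace I u.proj :=
  mfderiv I.tangent I (fun w : TangentBundle I M => w.proj) u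

/-- The pull-back connection `∇^*` on `π^*TM`. -/
def pullback (D : CovariantDerivative I E (TangentSpace I : M → Type _))
    (σ : Π w : TangentBundle I M, TangentSpace I w.proj) (u : TangentBundle I M) :
    TangentSpace I.tangent u →L[ℝ] TangentSpace I u.proj :=
  pullbackConnection I.tangent D (fun w : TangentBundle I M => w.proj) σ u

/-- The vertical component `X ↦ X^v = ∇^*_X ξ`, as an element of `π^*TM`; here `ξ_u = u` is the
canonical section. The horizontal space `H_u` is its kernel. -/
def vert (D : CovariantDerivative I E (TangentSpace I : M → Type _)) (u : TangentBundle I M) :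
    TangentSpace I.tangent u →L[ℝ] TangentSpace I u.proj :=
  pullback D (fun w => w.snd) u

/-- The inclusion of the fibre `T_x M`, with its underlying vector space `E`, in `TM`. -/
def fibreInclusion (x : M) (v : E) : TangentBundle I M :=
  ⟨x, v⟩

/-- The canonical identification of `T_x M` with the vertical space `V_u = ker dπ`, `x = π u`:
the differential at `u` of the inclusion of the fibre `T_x M` in `TM`. -/
def vLift (u : TangentBundle I M) : TangentSpace I u.proj →L[ℝ] TangentSpace I.tangent u :=
  mfderiv 𝓘(ℝ, E) I.tangent (fibreInclusion (I := I) u.proj) u.snd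

/-- The horizontal lift `T_x M → H_u`, `x = π u`: the inverse of `dπ` on `H_u = ker (∇^* ξ)`. -/
def hLift (D : CovariantDerivative I E (TangentSpace I : M → Type _)) (u : TangentBundle I M) :
    TangentSpace I u.proj →L[ℝ] TangentSpace I.tangent u :=
  (((dproj u).prod (vert D u)).inverse).comp
    (ContinuousLinearMap.inl ℝ (TangentSpace I u.proj) (TangentSpace I u.proj))

section Splitting

/-- The fibre component of `w` in the trivialization of `TM` around `x`. -/
def fibreCoord (x : M) (w : TangentBundle I M) : E :=
  ((trivializationAt E (TangentSpace I : M → Type _) x) w).2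

theorem mdifferentiableAt_fibreCoord (u : TangentBundle I M) :
    MDifferentiableAt I.tangent 𝓘(ℝ, E) (fibreCoord (I := I) u.proj) u :=
  (((trivializationAt E (TangentSpace I : M → Type _) u.proj).mdifferentiable
    (TangentSpace I : M → Type _) (I := I)).mdifferentiableAt
      (mem_trivializationAt_proj_source (F := E) (E := (TangentSpace I : M → Type _)))).snd

theorem vert_apply (D : CovariantDerivative I E (TangentSpace I : M → Type _))
    (u : TangentBundle I M) (X : TangentSpace I.tangent u) :
    vert D u X =
      (trivializationAt E (TangentSpace I : M → Type _) u.proj).symmL ℝ u.proj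
        (mvfderiv I.tangent (fibreCoord (I := I) u.proj) u X)
      + D (extend E u.snd) u.proj (dproj u X) := rfl

theorem eq_zero_of_dproj_of_fibreCoord (u : TangentBundle I M) (X : TangentSpace I.tangent u)
    (h1 : dproj u X = 0) (h2 : mvfderiv I.tangent (fibreCoord (I := I) u.proj) u X = 0) :
    X = 0 := by
  have he := ((trivializationAt E (TangentSpace I : M → Type _) u.proj).mdifferentiable
    (TangentSpace I : M → Type _) (I := I)).mfderiv_injective
      (mem_trivializationAt_proj_source (F := E) (E := (TangentSpace I : M → Type _)) (x := u))
  have heq : ((trivializationAt E (TangentSpace I : M → Type _) u.proj) :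
      TangentBundle I M → M × E) = fun w => (w.proj, fibreCoord (I := I) u.proj w) := by
    funext w
    exact Prod.ext (TangentBundle.trivializationAt_fst (I := I) u.proj w) rfl
  refine he ?_
  rw [map_zero]
  change mfderiv I.tangent (I.prod 𝓘(ℝ, E)) ((trivializationAt E (TangentSpace I : M → Type _)
    u.proj) : TangentBundle I M → M × E) u X = 0
  rw [heq, mfderiv_prodMk (Bundle.mdifferentiableAt_proj (TangentSpace I : M → Type _))
    (mdifferentiableAt_fibreCoord u)]
  exact Prod.ext h1 h2

theorem isInvertible_splitting [FiniteDimensional ℝ E]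
    (D : CovariantDerivative I E (TangentSpace I : M → Type _)) (u : TangentBundle I M) :
    ((dproj u).prod (vert D u)).IsInvertible := by
  have : FiniteDimensional ℝ (TangentSpace I u.proj) := inferInstanceAs (FiniteDimensional ℝ E)
  have : FiniteDimensional ℝ (TangentSpace I.tangent u) :=
    inferInstanceAs (FiniteDimensional ℝ (E × E))
  have : T2Space (TangentSpace I.tangent u) := inferInstanceAs (T2Space (E × E))
  have : T2Space (TangentSpace I u.proj) := inferInstanceAs (T2Space E)
  have hinj : Function.Injective ((dproj u).prod (vert D u)).toLinearMap := by
    rw [injective_iff_map_eq_zero]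
    intro X hX
    have h1 : dproj u X = 0 := congrArg Prod.fst hX
    have h2 : vert D u X = 0 := congrArg Prod.snd hX
    rw [vert_apply, h1, map_zero, add_zero] at h2
    refine eq_zero_of_dproj_of_fibreCoord u X h1 ?_
    have h3 := congrArg ((trivializationAt E (TangentSpace I : M → Type _)
      u.proj).continuousLinearMapAt ℝ u.proj) h2
    rwa [Bundle.Trivialization.continuousLinearMapAt_symmL _
      (mem_baseSet_trivializationAt' u.proj), map_zero] at h3
  have hfr : Module.finrank ℝ (TangentSpace I.tangent u) =
      Module.finrank ℝ (TangentSpace I u.proj × TangentSpace I u.proj) := rfl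
  let L := LinearEquiv.ofInjectiveOfFinrankEq _ hinj hfr
  exact ⟨L.toContinuousLinearEquiv, by ext X <;> rfl⟩

theorem splitting_hLift [FiniteDimensional ℝ E]
    (D : CovariantDerivative I E (TangentSpace I : M → Type _)) (u : TangentBundle I M)
    (a : TangentSpace I u.proj) : (dproj u).prod (vert D u) (hLift D u a) = (a, 0) :=
  (isInvertible_splitting D u).self_apply_inverse (a, 0)

theorem dproj_hLift [FiniteDimensional ℝ E]
    (D : CovariantDerivative I E (TangentSpace I : M → Type _)) (u : TangentBundle I M)
    (a : TangentSpace I u.proj) : dproj u (hLift D u a) = a :=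
  congrArg Prod.fst (splitting_hLift D u a)

theorem vert_hLift [FiniteDimensional ℝ E]
    (D : CovariantDerivative I E (TangentSpace I : M → Type _)) (u : TangentBundle I M)
    (a : TangentSpace I u.proj) : vert D u (hLift D u a) = 0 :=
  congrArg Prod.snd (splitting_hLift D u a)

/-- The restriction of the fibre component to the fibre over `x`. -/
def fibreMap (x : M) : E →L[ℝ] E :=
  (trivializationAt E (TangentSpace I : M → Type _) x).continuousLinearMapAt ℝ x

theorem fibreMap_apply (x : M) (v : E) :
    fibreMap (I := I) x v = fibreCoord (I := I) x (fibreInclusion x v) := by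
  have := Bundle.Trivialization.coe_linearMapAt_of_mem (R := ℝ)
    (trivializationAt E (TangentSpace I : M → Type _) x) (mem_baseSet_trivializationAt' x)
  exact congrFun this v

theorem mdifferentiableAt_fibreInclusion (x : M) (v : E) :
    MDifferentiableAt 𝓘(ℝ, E) I.tangent (fibreInclusion (I := I) x) v := by
  refine (mdifferentiableAt_totalSpace I (fibreInclusion (I := I) x)).2
    ⟨mdifferentiableAt_const, ?_⟩
  have h : (fun v : E => fibreCoord (I := I) x (fibreInclusion x v)) = fibreMap (I := I) x :=
    funext fun v => (fibreMap_apply x v).symm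
  change MDifferentiableAt 𝓘(ℝ, E) 𝓘(ℝ, E)
    (fun v : E => fibreCoord (I := I) x (fibreInclusion x v)) v
  rw [h]
  exact (fibreMap (I := I) x).differentiableAt.mdifferentiableAt

theorem mfderiv_fibreCoord_comp (x : M) (v : E) :
    (mfderiv I.tangent 𝓘(ℝ, E) (fibreCoord (I := I) x) (fibreInclusion x v)).comp
      (mfderiv 𝓘(ℝ, E) I.tangent (fibreInclusion (I := I) x) v) = fibreMap (I := I) x := by
  have h := mfderiv_comp (I := 𝓘(ℝ, E)) (I' := I.tangent) (I'' := 𝓘(ℝ, E)) v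
    (g := fibreCoord (I := I) x) (f := fibreInclusion (I := I) x)
    (mdifferentiableAt_fibreCoord (fibreInclusion x v)) (mdifferentiableAt_fibreInclusion x v)
  have h0 : fibreCoord (I := I) x ∘ fibreInclusion x = fibreMap (I := I) x :=
    funext fun v => (fibreMap_apply x v).symm
  rw [h0, mfderiv_eq_fderiv, ContinuousLinearMap.fderiv] at h
  exact h.symm

theorem dproj_vLift (u : TangentBundle I M) (b : TangentSpace I u.proj) :
    dproj u (vLift u b) = 0 := by
  have h := mfderiv_comp (I := 𝓘(ℝ, E)) (I' := I.tangent) (I'' := I) (u.snd)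
    (g := fun w : TangentBundle I M => w.proj)
    (f := fibreInclusion (I := I) u.proj)
    (Bundle.mdifferentiableAt_proj (TangentSpace I : M → Type _))
    (mdifferentiableAt_fibreInclusion (E := E) u.proj u.snd)
  have h0 : mfderiv 𝓘(ℝ, E) I ((fun w : TangentBundle I M => w.proj) ∘
    fibreInclusion (I := I) u.proj) u.snd = 0 := mfderiv_const
  rw [h0] at h
  exact (DFunLike.congr_fun h b).symm

theorem vert_vLift
    (D : CovariantDerivative I E (TangentSpace I : M → Type _)) (u : TangentBundle I M)
    (b : TangentSpace I u.proj) : vert D u (vLift u b) = b := by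
  rw [vert_apply, dproj_vLift, map_zero, add_zero]
  have h1 : mvfderiv I.tangent (fibreCoord (I := I) u.proj) u (vLift u b) =
      fibreMap (I := I) u.proj b := DFunLike.congr_fun (mfderiv_fibreCoord_comp (I := I) (E := E) u.proj u.snd) b
  rw [h1]
  exact Bundle.Trivialization.symmL_continuousLinearMapAt _
    (mem_baseSet_trivializationAt' u.proj) b

end Splitting

/-! ### The weighted metric and the tensors on `TM` -/

/-- `f₁ π^*g ⊕ f₂ π^*g` on `H ⊕ V`, with `f₁ = exp (2 φ₁)`, `f₂ = exp (2 φ₂)`. -/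
def weightedMetric (g : ContMDiffRiemannianMetric I ∞ E (TangentSpace I : M → Type _))
    (D : CovariantDerivative I E (TangentSpace I : M → Type _)) (φ₁ φ₂ : M → ℝ)
    (u : TangentBundle I M) (X Y : TangentSpace I.tangent u) : ℝ :=
  Real.exp (2 * φ₁ u.proj) * g.inner u.proj (dproj u X) (dproj u Y)
    + Real.exp (2 * φ₂ u.proj) * g.inner u.proj (vert D u X) (vert D u Y)

/-- `C (a, b) = a(φ) b + b(φ) a - ⟨a, b⟩ grad φ`. -/
def confTensor (g : ContMDiffRiemannianMetric I ∞ E (TangentSpace I : M → Type _)) (φ : M → ℝ)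
    (x : M) (a b : TangentSpace I x) : TangentSpace I x :=
  mvfderiv I φ x a • b + mvfderiv I φ x b • a - g.inner x a b • grad g φ x

/-- The direct sum connection `D^*` on `H ⊕ V`: on sections `Y` of `H` it is
`∇^*_X Y + π^*C₁ (X, Y)`, on sections `Y` of `V` it is `∇^*_X Y + X(φ₂) Y`. -/
def Dstar (g : ContMDiffRiemannianMetric I ∞ E (TangentSpace I : M → Type _))
    (D : CovariantDerivative I E (TangentSpace I : M → Type _)) (φ₁ φ₂ : M → ℝ)
    (u : TangentBundle I M) (X : TangentSpace I.tangent u)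
    (Y : Π w : TangentBundle I M, TangentSpace I.tangent w) : TangentSpace I.tangent u :=
  hLift D u (pullback D (fun w => dproj w (Y w)) u X
      + confTensor g φ₁ u.proj (dproj u X) (dproj u (Y u)))
    + vLift u (pullback D (fun w => vert D w (Y w)) u X
      + mvfderiv I φ₂ u.proj (dproj u X) • vert D u (Y u))

/-- `R^* (X, Y) ξ = π^*R^∇ (X, Y) ξ`, a section of `π^*TM`. -/
def curvXi (D : CovariantDerivative I E (TangentSpace I : M → Type _)) (u : TangentBundle I M)
    (X Y : TangentSpace I.tangent u) : TangentSpace I u.proj :=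
  curvature D u.proj (dproj u X) (dproj u Y) u.snd

/-- The `V`-valued tensor `𝓡 = R^* ξ`. -/
def Rcal (D : CovariantDerivative I E (TangentSpace I : M → Type _)) (u : TangentBundle I M)
    (X Y : TangentSpace I.tangent u) : TangentSpace I.tangent u :=
  vLift u (curvXi D u X Y)

/-- The `H`-valued tensor `A` with
`f₁ ⟨A_X Y, Z⟩ = (f₂ / 2) (⟨R^*(X^h, Z^h) ξ, Y^v⟩ + ⟨R^*(Y^h, Z^h) ξ, X^v⟩)`. -/
def tensorA (g : ContMDiffRiemannianMetric I ∞ E (TangentSpace I : M → Type _))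
    (D : CovariantDerivative I E (TangentSpace I : M → Type _)) (φ₁ φ₂ : M → ℝ)
    (u : TangentBundle I M) (X Y : TangentSpace I.tangent u) : TangentSpace I.tangent u :=
  hLift D u (sharp g u.proj fun z =>
    (Real.exp (2 * φ₁ u.proj))⁻¹ * (Real.exp (2 * φ₂ u.proj) / 2 *
      (g.inner u.proj (curvature D u.proj (dproj u X) z u.snd) (vert D u Y)
        + g.inner u.proj (curvature D u.proj (dproj u Y) z u.snd) (vert D u X))))

/-- `B (X, Y) = Y(φ₂) X^v - (f₂ / f₁) ⟨X^v, Y^v⟩ grad φ₂`, with the horizontal lift of the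
gradient. -/
def tensorB (g : ContMDiffRiemannianMetric I ∞ E (TangentSpace I : M → Type _))
    (D : CovariantDerivative I E (TangentSpace I : M → Type _)) (φ₁ φ₂ : M → ℝ)
    (u : TangentBundle I M) (X Y : TangentSpace I.tangent u) : TangentSpace I.tangent u :=
  mvfderiv I φ₂ u.proj (dproj u Y) • vLift u (vert D u X)
    - (Real.exp (2 * φ₂ u.proj) / Real.exp (2 * φ₁ u.proj)
        * g.inner u.proj (vert D u X) (vert D u Y)) • hLift D u (grad g φ₂ u.proj)

section Torsion

variable [FiniteDimensional ℝ E]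

/-- `T (a, b, c) = ⟨T^∇ (a, b), c⟩`. -/
def torsionForm (g : ContMDiffRiemannianMetric I ∞ E (TangentSpace I : M → Type _))
    (D : CovariantDerivative I E (TangentSpace I : M → Type _)) (x : M)
    (a b c : TangentSpace I x) : ℝ :=
  g.inner x (D.torsion x a b) c

/-- The `H`-valued tensor `τ` with
`⟨τ_X Y, Z^h⟩ = (T (Y, X, Z) + T (X, Z, Y) + T (Y, Z, X)) / 2`, where `T` is pulled back by `π`. -/
def tensorTau (g : ContMDiffRiemannianMetric I ∞ E (TangentSpace I : M → Type _))
    (D : CovariantDerivative I E (TangentSpace I : M → Type _))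
    (u : TangentBundle I M) (X Y : TangentSpace I.tangent u) : TangentSpace I.tangent u :=
  hLift D u (sharp g u.proj fun z =>
    (torsionForm g D u.proj (dproj u Y) (dproj u X) z
      + torsionForm g D u.proj (dproj u X) z (dproj u Y)
      + torsionForm g D u.proj (dproj u Y) z (dproj u X)) / 2)

end Torsion

end TangentConn

end

/-! A Levi-Civita connection is unique by the Koszul formula, so it is enough that the right-hand
side of the asserted formula is a torsion-free metric connection. A tangent vector of TM is
determined by its components `dproj` and `vert` in π^*TM, and both properties are checked there,
using the pull-back connection ∇^*.

Torsion: ∇^* satisfies two structure equations. The alternation of ∇^*_X(dπ Y), minus dπ[X,Y], is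
T(dπ X, dπ Y) (`pullback_dproj_sub`). Since X^v = ∇^*_X ξ, the same expression for the vertical
components is the commutator of covariant derivatives applied to ξ, that is R^*(X,Y)ξ
(`pullback_vert_sub`). The alternation of τ is -T and that of -R^*ξ/2 is -R^*ξ, which cancels both.
C_1 and A are symmetric, as is the sum X(φ_2)Y^v + Y(φ_2)X^v of the terms from D^* and B, and so is
the gradient term of B.

Metricity: ∇^* is metric for π^*g, and the terms of D^* containing φ_1 and φ_2 produce the
derivatives of f_1 and f_2, so D^* preserves G. The corrections A - R^*ξ/2, B and τ are each skew
for G in their last two arguments, by antisymmetry of R and T in the first two.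

The structure equations hold along any smooth map. They are proved in a trivialization, where a
connection is d plus its coefficients (`coord_pullbackConnection`): second derivatives combine into
Lie brackets by `mvfderiv_mlieBracket`, and the remaining terms are the coordinate expressions of
torsion and curvature. Smoothness of the Levi-Civita connection also comes from the Koszul formula,
by inverting the matrix of the metric. -/

noncomputable section

open Filter Topology VectorField

set_option linter.unusedSectionVars false

/-! ### Derivatives of functions along vector fields -/

section VectorFieldsOnFunctions

variable {E : Type*} [NormedAddCommGroup E] [NormedSpace ℝ E]
  {H : Type*} [TopologicalSpace H] {I : ModelWithCorners ℝ E H}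
  {M : Type*} [TopologicalSpace M] [ChartedSpace H M]
  {F : Type*} [NormedAddCommGroup F] [NormedSpace ℝ F]
  {f : M → F} {X Y : Π x : M, TangentSpace I x} {x : M}

/-- The derivative `X f` of a `C^n` function along a `C^m` vector field is `C^m` if `m + 1 ≤ n`. -/
theorem ContMDiffAt.mvfderiv_apply [IsManifold I 1 M] {m n : ℕ∞ω}
    (hf : ContMDiffAt I 𝓘(ℝ, F) n f x) (hX : CMDiffAt m (T% X) x) (hmn : m + 1 ≤ n) :
    ContMDiffAt I 𝓘(ℝ, F) m (fun y => mvfderiv I f y (X y)) x := by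
  have h := ContMDiffAt.clm_apply_of_inCoordinates (IM := I) (IB₁ := I) (IB₂ := 𝓘(ℝ, F)) (F₁ := E)
    (E₁ := (TangentSpace I : M → Type _)) (F₂ := F) (E₂ := (TangentSpace 𝓘(ℝ, F) : F → Type _))
    (b₁ := id) (b₂ := f) (ϕ := fun y => mfderiv I 𝓘(ℝ, F) f y) (v := X)
    (hf.mfderiv_const hmn) hX (hf.of_le (le_self_add.trans hmn))
  exact (contMDiff_snd_tangentBundle_modelSpace F 𝓘(ℝ, F)).contMDiffAt.comp x h

/-- The derivative `X f` of a `C^2` function along a differentiable vector field is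
differentiable. -/
theorem MDifferentiableAt.mvfderiv_apply [IsManifold I 1 M]
    (hf : ContMDiffAt I 𝓘(ℝ, F) 2 f x) (hX : MDiffAt (T% X) x) :
    MDifferentiableAt I 𝓘(ℝ, F) (fun y => mvfderiv I f y (X y)) x := by
  have h := MDifferentiableAt.clm_apply_of_inCoordinates (IM := I) (IB₁ := I) (IB₂ := 𝓘(ℝ, F))
    (F₁ := E)
    (E₁ := (TangentSpace I : M → Type _)) (F₂ := F) (E₂ := (TangentSpace 𝓘(ℝ, F) : F → Type _))
    (b₁ := id) (b₂ := f) (ϕ := fun y => mfderiv I 𝓘(ℝ, F) f y) (v := X)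
    ((hf.mfderiv_const (m := 1) (by norm_num)).mdifferentiableAt one_ne_zero) hX
    (hf.mdifferentiableAt two_ne_zero)
  exact ((contMDiff_snd_tangentBundle_modelSpace (n := 1) F 𝓘(ℝ, F)).mdifferentiable
    one_ne_zero).mdifferentiableAt.comp x h

/-- The Lie bracket acts on `C^2` functions as the commutator of derivations. -/
theorem mvfderiv_mlieBracket [I.Boundaryless] [IsManifold I 2 M] [CompleteSpace E]
    (hf : ContMDiffAt I 𝓘(ℝ, F) 2 f x) (hX : MDiffAt (T% X) x) (hY : MDiffAt (T% Y) x) :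
    mvfderiv I f x (VectorField.mlieBracket I X Y x) =
      mvfderiv I (fun y => mvfderiv I f y (Y y)) x (X x)
        - mvfderiv I (fun y => mvfderiv I f y (X y)) x (Y x) := by
  have : IsManifold I 1 M := .of_le one_le_two
  set φ := extChartAt I x
  set p := φ x with hp
  -- `P Z` is `Z` read in the chart. Without boundary the range of `I` is everything, so derivatives
  -- within it are ordinary ones.
  let P (Z : Π x : M, TangentSpace I x) : E → E :=
    VectorField.mpullbackWithin 𝓘(ℝ, E) I φ.symm Z (Set.range I)
  set f' : E → F := f ∘ φ.symm with hf'
  have hf'2 : ContDiffAt ℝ 2 f' p := by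
    have := (contMDiffAt_iff.1 hf).2
    rw [I.range_eq_univ] at this
    exact contDiffWithinAt_univ.1 this
  have hpz : φ.symm p = x := extChartAt_to_inv x
  have htgt : ∀ᶠ y in 𝓝 p, y ∈ φ.target := extChartAt_target_mem_nhds x
  have hfd : ∀ᶠ y in 𝓝 p, MDifferentiableAt I 𝓘(ℝ, F) f (φ.symm y) := by
    have h1 : ∀ᶠ z in 𝓝 x, ContMDiffAt I 𝓘(ℝ, F) 2 f z :=
      (contMDiffAt_iff_contMDiffAt_nhds (by simp)).1 hf
    have hc : ContinuousAt φ.symm p := continuousAt_extChartAt_symm x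
    have h2 := hc.eventually (by rwa [hpz] : ∀ᶠ z in 𝓝 (φ.symm p), ContMDiffAt I 𝓘(ℝ, F) 2 f z)
    exact h2.mono fun y hy => hy.mdifferentiableAt two_ne_zero
  have hsymm : ∀ y ∈ φ.target, MDifferentiableAt 𝓘(ℝ, E) I φ.symm y := fun y hy =>
    ((contMDiffOn_extChartAt_symm (n := 1) x).contMDiffAt
      ((isOpen_extChartAt_target x).mem_nhds hy)).mdifferentiableAt one_ne_zero
  have hlift : ∀ y ∈ φ.target, ∀ Z : Π x : M, TangentSpace I x,
      mfderiv 𝓘(ℝ, E) I φ.symm y (P Z y) = Z (φ.symm y) := by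
    intro y hy Z
    have hinv := isInvertible_mfderivWithin_extChartAt_symm (I := I) hy
    have h2 : P Z y = (mfderivWithin 𝓘(ℝ, E) I φ.symm (Set.range I) y).inverse (Z (φ.symm y)) := rfl
    rw [h2, ← mfderivWithin_univ, ← I.range_eq_univ]
    exact hinv.self_apply_inverse _
  have key : ∀ y ∈ φ.target, MDifferentiableAt I 𝓘(ℝ, F) f (φ.symm y) →
      ∀ Z : Π x : M, TangentSpace I x,
      fderiv ℝ f' y (P Z y) = mvfderiv I f (φ.symm y) (Z (φ.symm y)) := by
    intro y hy hfy Z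
    have h1 := mfderiv_comp (I := 𝓘(ℝ, E)) (I' := I) (I'' := 𝓘(ℝ, F)) y hfy (hsymm y hy)
    rw [mfderiv_eq_fderiv] at h1
    have h4 : fderiv ℝ f' y (P Z y) = mfderiv I 𝓘(ℝ, F) f (φ.symm y)
        (mfderiv 𝓘(ℝ, E) I φ.symm y (P Z y)) := DFunLike.congr_fun h1 _
    rw [h4, hlift y hy Z]; rfl
  have hP : ∀ Z : Π x : M, TangentSpace I x, MDiffAt (T% Z) x → DifferentiableAt ℝ (P Z) p := by
    intro Z hZ
    have := (mdifferentiableWithinAt_univ.2 hZ).differentiableWithinAt_mpullbackWithin_vectorField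
    have h2 : φ.symm ⁻¹' Set.univ ∩ Set.range I = Set.univ := by simp [I.range_eq_univ]
    rw [h2] at this
    exact differentiableWithinAt_univ.1 this
  have hd2 : DifferentiableAt ℝ (fderiv ℝ f') p :=
    (hf'2.fderiv_right (m := 1) (by norm_num)).differentiableAt one_ne_zero
  -- In the chart, W(Zf) is a Hessian term in (W, Z) plus df applied to the derivative of Z along W.
  -- The Hessian terms cancel in the commutator by symmetry; the others give the bracket.
  have hder : ∀ Z W : Π x : M, TangentSpace I x, MDiffAt (T% Z) x →
      mvfderiv I (fun y => mvfderiv I f y (Z y)) x (W x) =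
        fderiv ℝ (fderiv ℝ f') p (P W p) (P Z p) + fderiv ℝ f' p (fderiv ℝ (P Z) p (P W p)) := by
    intro Z W hZ
    have h1 : MDifferentiableAt I 𝓘(ℝ, F) (fun y => mvfderiv I f y (Z y)) x :=
      MDifferentiableAt.mvfderiv_apply hf hZ
    have h2 : mvfderiv I (fun y => mvfderiv I f y (Z y)) x (W x) =
        fderiv ℝ (fun y => mvfderiv I f (φ.symm y) (Z (φ.symm y))) p (P W p) := by
      have h3 := mfderiv_comp (I := 𝓘(ℝ, E)) (I' := I) (I'' := 𝓘(ℝ, F)) p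
        (f := φ.symm) (g := fun y => mvfderiv I f y (Z y)) (by rwa [hpz])
        (hsymm p htgt.self_of_nhds)
      rw [mfderiv_eq_fderiv] at h3
      have h4 : mfderiv 𝓘(ℝ, E) I φ.symm p (P W p) = W (φ.symm p) := hlift p htgt.self_of_nhds W
      have h5 := DFunLike.congr_fun h3 (P W p)
      refine Eq.trans ?_ h5.symm
      change _ = mfderiv I 𝓘(ℝ, F) (fun y => mvfderiv I f y (Z y)) (φ.symm p)
        (mfderiv 𝓘(ℝ, E) I φ.symm p (P W p))
      rw [h4, hpz]
      rfl
    have h3 : (fun y => mvfderiv I f (φ.symm y) (Z (φ.symm y))) =ᶠ[𝓝 p]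
        fun y => fderiv ℝ f' y (P Z y) := by
      filter_upwards [htgt, hfd] with y hy hfy
      exact (key y hy hfy Z).symm
    rw [h2, h3.fderiv_eq, fderiv_clm_apply hd2 (hP Z hZ)]
    simp [add_comm]
  have hbr : mvfderiv I f x (VectorField.mlieBracket I X Y x) =
      fderiv ℝ f' p (fderiv ℝ (P Y) p (P X p) - fderiv ℝ (P X) p (P Y p)) := by
    let L : E := VectorField.lieBracket ℝ (P X) (P Y) p
    have h1 : VectorField.mlieBracket I X Y x = (mfderiv I 𝓘(ℝ, E) φ x).inverse
        L := by
      change _ = (mfderiv I 𝓘(ℝ, E) φ x).inverse (VectorField.lieBracket ℝ (P X) (P Y) p : E)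
      rw [← VectorField.lieBracketWithin_univ, ← VectorField.mlieBracketWithin_univ,
        VectorField.mlieBracketWithin_apply, I.range_eq_univ, Set.preimage_univ, Set.univ_inter,
        ← I.range_eq_univ]
    have h2 := mfderiv_comp (I := I) (I' := 𝓘(ℝ, E)) (I'' := 𝓘(ℝ, F)) x (f := φ) (g := f')
      (hf'2.differentiableAt two_ne_zero).mdifferentiableAt
      (mdifferentiableAt_extChartAt (mem_chart_source H x))
    have h3 : f' ∘ φ =ᶠ[𝓝 x] f := by
      filter_upwards [extChartAt_source_mem_nhds (I := I) x] with y hy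
      exact congrArg f ((extChartAt I x).left_inv hy)
    rw [h3.mfderiv_eq] at h2
    have h4 := DFunLike.congr_fun h2 (VectorField.mlieBracket I X Y x)
    refine h4.trans ?_
    rw [h1]
    change mfderiv 𝓘(ℝ, E) 𝓘(ℝ, F) f' (φ x) (mfderiv I 𝓘(ℝ, E) φ x
      ((mfderiv I 𝓘(ℝ, E) φ x).inverse L)) = _
    have h5 : mfderiv I 𝓘(ℝ, E) φ x
        ((mfderiv I 𝓘(ℝ, E) φ x).inverse L) =
        L :=
      (isInvertible_mfderiv_extChartAt (mem_extChartAt_source x)).self_apply_inverse _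
    rw [h5, mfderiv_eq_fderiv]
    rfl
  have hs : fderiv ℝ (fderiv ℝ f') p (P X p) (P Y p) = fderiv ℝ (fderiv ℝ f') p (P Y p) (P X p) :=
    (hf'2.isSymmSndFDerivAt (by simp)) _ _
  rw [hbr, hder Y X hY, hder X Y hX, hs, map_sub]
  abel

end VectorFieldsOnFunctions

/-! ### Coordinates in the preferred trivializations -/

/-- In a basis of the finite-dimensional source, an operator is a finite sum of rank-one maps
depending linearly on its values on basis vectors. -/
theorem ContMDiffAt.of_clm_apply {E : Type*} [NormedAddCommGroup E] [NormedSpace ℝ E]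
    {H : Type*} [TopologicalSpace H] {I : ModelWithCorners ℝ E H}
    {M : Type*} [TopologicalSpace M] [ChartedSpace H M]
    {F : Type*} [NormedAddCommGroup F] [NormedSpace ℝ F] [FiniteDimensional ℝ F]
    {F' : Type*} [NormedAddCommGroup F'] [NormedSpace ℝ F'] {n : ℕ∞ω}
    {T : M → F →L[ℝ] F'} {x : M}
    (h : ∀ a, ContMDiffAt I 𝓘(ℝ, F') n (fun y => T y a) x) :
    ContMDiffAt I 𝓘(ℝ, F →L[ℝ] F') n T x := by
  let b := Module.finBasis ℝ F
  let c (i) : F →L[ℝ] ℝ := LinearMap.toContinuousLinearMap (b.coord i)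
  have hT : T = fun y => ∑ i, ContinuousLinearMap.smulRightL ℝ F F' (c i) (T y (b i)) := by
    funext y
    ext a
    have h := congrArg (T y) (b.sum_repr a)
    rw [map_sum] at h
    simp [c, ← h]
  rw [hT]
  refine contMDiffAt_finsetSum fun i _ => ?_
  exact (ContinuousLinearMap.contMDiff _).contMDiffAt.comp x (h (b i))

/-- No derivative is lost, because ∞ + 1 = ∞. -/
theorem contMDiffVectorBundle_tangentSpace {E : Type*} [NormedAddCommGroup E] [NormedSpace ℝ E]
    {H : Type*} [TopologicalSpace H] {I : ModelWithCorners ℝ E H}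
    {M : Type*} [TopologicalSpace M] [ChartedSpace H M] [IsManifold I ∞ M] :
    ContMDiffVectorBundle ∞ E (TangentSpace I : M → Type _) I :=
  have : IsManifold I (∞ + 1) M := ‹IsManifold I ∞ M›
  TangentBundle.contMDiffVectorBundle

attribute [local instance] contMDiffVectorBundle_tangentSpace

namespace TangentConn

variable {E : Type*} [NormedAddCommGroup E] [NormedSpace ℝ E]
  {H : Type*} [TopologicalSpace H] {I : ModelWithCorners ℝ E H}
  {M : Type*} [TopologicalSpace M] [ChartedSpace H M] [IsManifold I ∞ M]

/-- The components of a tangent vector at `y` in the preferred trivialization at `x`. -/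
def coord (x y : M) : TangentSpace I y →L[ℝ] E :=
  (trivializationAt E (TangentSpace I : M → Type _) x).continuousLinearMapAt ℝ y

/-- The vector field with constant components `a` in the preferred trivialization at `x`. -/
def coordField (x : M) (a : E) (y : M) : TangentSpace I y :=
  (trivializationAt E (TangentSpace I : M → Type _) x).symmL ℝ y a

theorem coord_coordField {x y : M} (hy : y ∈ (chartAt H x).source) (a : E) :
    coord x y (coordField (I := I) x a y) = a :=
  Trivialization.continuousLinearMapAt_symmL _ hy a

theorem coordField_coord {x y : M} (hy : y ∈ (chartAt H x).source) (v : TangentSpace I y) :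
    coordField x (coord x y v) y = v :=
  Trivialization.symmL_continuousLinearMapAt _ hy v

theorem coord_apply {x y : M} (hy : y ∈ (chartAt H x).source) (v : TangentSpace I y) :
    coord x y v = ((trivializationAt E (TangentSpace I : M → Type _) x) ⟨y, v⟩).2 :=
  Trivialization.continuousLinearMapAt_apply_of_mem ℝ _ hy v

theorem coord_injective {x y : M} (hy : y ∈ (chartAt H x).source) {v w : TangentSpace I y}
    (h : coord x y v = coord x y w) : v = w := by
  rw [← coordField_coord hy v, h, coordField_coord hy]

theorem coordField_add (x : M) (a b : E) :
    coordField (I := I) x (a + b) = coordField x a + coordField x b :=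
  funext fun _ => map_add _ a b

theorem coordField_smul (x : M) (c : ℝ) (a : E) :
    coordField (I := I) x (c • a) = c • coordField x a :=
  funext fun _ => map_smul _ c a

/-- By locality of connections, this allows `extend`, which occurs in the definitions, to be
replaced by a coordinate field. -/
theorem extend_eventuallyEq {x : M} (v : TangentSpace I x) :
    ∀ᶠ y in 𝓝 x, extend E v y = coordField x (coord x x v) y := by
  filter_upwards [(chartAt H x).open_source.mem_nhds (mem_chart_source H x)] with y hy
  rw [coord_apply (mem_chart_source H x)]
  exact (Trivialization.symmL_apply _ hy _).symm

/-! ### Sections along a map, in coordinates -/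

section Along

variable {E' : Type*} [NormedAddCommGroup E'] [NormedSpace ℝ E']
  {H' : Type*} [TopologicalSpace H'] {J : ModelWithCorners ℝ E' H'}
  {N : Type*} [TopologicalSpace N] [ChartedSpace H' N]
  {f : N → M} {σ : Π w, TangentSpace I (f w)} {w : N} {x : M}

theorem eventually_coord_eq (hf : ContinuousAt f w) (hw : f w ∈ (chartAt H x).source) :
    (fun w' => coord x (f w') (σ w')) =ᶠ[𝓝 w]
      fun w' => ((trivializationAt E (TangentSpace I : M → Type _) x) ⟨f w', σ w'⟩).2 := by
  filter_upwards [hf.eventually ((chartAt H x).open_source.mem_nhds hw)] with w' hw'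
  exact coord_apply hw' _

/-- In a trivialization the base part is `f` itself, so only the fibre part remains. The centre `x`
may differ from `f w`, which permits a change of trivialization. -/
theorem contMDiffAt_along_iff {n : ℕ∞ω} [ContMDiffVectorBundle n E (TangentSpace I : M → Type _) I]
    (hf : ContMDiffAt J I n f w) (hw : f w ∈ (chartAt H x).source) :
    ContMDiffAt J I.tangent n (fun w' => (⟨f w', σ w'⟩ : TangentBundle I M)) w ↔
      ContMDiffAt J 𝓘(ℝ, E) n (fun w' => coord x (f w') (σ w')) w := by
  rw [(eventually_coord_eq hf.continuousAt hw).contMDiffAt_iff]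
  have he : (⟨f w, σ w⟩ : TangentBundle I M) ∈
      (trivializationAt E (TangentSpace I : M → Type _) x).source :=
    (Trivialization.mem_source _).2 hw
  exact (Trivialization.contMDiffAt_iff (IM := J) (IB := I)
    (f := fun w' => (⟨f w', σ w'⟩ : TangentBundle I M))
    (e := trivializationAt E (TangentSpace I : M → Type _) x) he).trans (and_iff_right hf)

theorem mdifferentiableAt_along_iff
    (hf : MDifferentiableAt J I f w) (hw : f w ∈ (chartAt H x).source) :
    MDifferentiableAt J I.tangent (fun w' => (⟨f w', σ w'⟩ : TangentBundle I M)) w ↔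
      MDifferentiableAt J 𝓘(ℝ, E) (fun w' => coord x (f w') (σ w')) w := by
  rw [(eventually_coord_eq hf.continuousAt hw).mdifferentiableAt_iff]
  have he : (⟨f w, σ w⟩ : TangentBundle I M) ∈
      (trivializationAt E (TangentSpace I : M → Type _) x).source :=
    (Trivialization.mem_source _).2 hw
  exact (Trivialization.mdifferentiableAt_totalSpace_iff I
    (trivializationAt E (TangentSpace I : M → Type _) x)
    (fun w' => (⟨f w', σ w'⟩ : TangentBundle I M)) he).trans (and_iff_right hf)

end Along

theorem contMDiffAt_coordField {n : ℕ∞ω} [ContMDiffVectorBundle n E (TangentSpace I : M → Type _) I]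
    {x y : M} (hy : y ∈ (chartAt H x).source) (a : E) :
    CMDiffAt n (T% (coordField (I := I) x a)) y := by
  refine (contMDiffAt_along_iff (f := id) contMDiffAt_id hy).2 ?_
  refine (contMDiffAt_const (c := a)).congr_of_eventuallyEq ?_
  filter_upwards [(chartAt H x).open_source.mem_nhds hy] with z hz
  exact coord_coordField hz a

theorem mdifferentiableAt_coordField
    {x y : M} (hy : y ∈ (chartAt H x).source) (a : E) :
    MDiffAt (T% (coordField (I := I) x a)) y :=
  (contMDiffAt_coordField (n := 1) hy a).mdifferentiableAt one_ne_zero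

/-- A field of endomorphisms of the tangent bundle is `C^n` if its values on coordinate fields
have `C^n` components. -/
theorem contMDiffAt_hom_of_coord [FiniteDimensional ℝ E] {n : ℕ∞ω}
    [ContMDiffVectorBundle n E (TangentSpace I : M → Type _) I]
    {T : Π y : M, TangentSpace I y →L[ℝ] TangentSpace I y} {x : M}
    (h : ∀ a, ContMDiffAt I 𝓘(ℝ, E) n (fun y => coord x y (T y (coordField x a y))) x) :
    ContMDiffAt I (I.prod 𝓘(ℝ, E →L[ℝ] E)) n
      (fun y => (⟨y, T y⟩ : TotalSpace (E →L[ℝ] E)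
        fun y => TangentSpace I y →L[ℝ] TangentSpace I y)) x := by
  refine (contMDiffAt_hom_bundle _).2 ⟨contMDiffAt_id, ?_⟩
  exact ContMDiffAt.of_clm_apply h

/-- A field of bilinear forms on the tangent bundle is `C^n` if its values on coordinate fields
are `C^n`. -/
theorem contMDiffAt_bilin_of_coord [FiniteDimensional ℝ E] {n : ℕ∞ω}
    [ContMDiffVectorBundle n E (TangentSpace I : M → Type _) I]
    {B : Π y : M, TangentSpace I y →L[ℝ] TangentSpace I y →L[ℝ] ℝ} {x : M}
    (h : ∀ a c, ContMDiffAt I 𝓘(ℝ, ℝ) n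
      (fun y => B y (coordField x a y) (coordField x c y)) x) :
    ContMDiffAt I (I.prod 𝓘(ℝ, E →L[ℝ] E →L[ℝ] ℝ)) n
      (fun y => TotalSpace.mk' (E →L[ℝ] E →L[ℝ] ℝ)
        (E := fun y => TangentSpace I y →L[ℝ] TangentSpace I y →L[ℝ] ℝ) y (B y)) x := by
  refine (contMDiffAt_hom_bundle _).2 ⟨contMDiffAt_id, ?_⟩
  refine ContMDiffAt.of_clm_apply fun a => ContMDiffAt.of_clm_apply fun c => ?_
  refine (h a c).congr_of_eventuallyEq ?_
  filter_upwards [(chartAt H x).open_source.mem_nhds (mem_chart_source H x)] with y hy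
  have hy' : y ∈ (trivializationAt E (TangentSpace I : M → Type _) x).baseSet := hy
  refine (inCoordinates_apply_eq₂ (E₃ := Bundle.Trivial M ℝ) hy' hy' (Set.mem_univ _)).trans ?_
  simp [coordField, Trivialization.symmL_apply _ hy']

theorem contMDiffAt_metric_apply {n : ℕ∞ω}
    [ContMDiffVectorBundle n E (TangentSpace I : M → Type _) I]
    (g : ContMDiffRiemannianMetric I n E (TangentSpace I : M → Type _))
    {E' : Type*} [NormedAddCommGroup E'] [NormedSpace ℝ E']
    {H' : Type*} [TopologicalSpace H'] {J : ModelWithCorners ℝ E' H'}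
    {N : Type*} [TopologicalSpace N] [ChartedSpace H' N]
    {f : N → M} {σ τ : Π w, TangentSpace I (f w)} {w : N} (hf : ContMDiffAt J I n f w)
    (hσ : ContMDiffAt J I.tangent n (fun w' => (⟨f w', σ w'⟩ : TangentBundle I M)) w)
    (hτ : ContMDiffAt J I.tangent n (fun w' => (⟨f w', τ w'⟩ : TangentBundle I M)) w) :
    ContMDiffAt J 𝓘(ℝ, ℝ) n (fun w => g.inner (f w) (σ w) (τ w)) w := by
  have : ContMDiffAt J (I.prod 𝓘(ℝ)) n
      (fun m => TotalSpace.mk' ℝ (E := Bundle.Trivial M ℝ) (f m) (g.inner (f m) (σ m) (τ m))) w := by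
    apply ContMDiffAt.clm_bundle_apply₂ (F₁ := E) (F₂ := E)
    · exact ContMDiffAt.comp w g.contMDiff.contMDiffAt hf
    · exact hσ
    · exact hτ
  simp only [contMDiffAt_totalSpace] at this
  exact this.2

theorem mdifferentiableAt_metric_apply
    (g : ContMDiffRiemannianMetric I ∞ E (TangentSpace I : M → Type _))
    {E' : Type*} [NormedAddCommGroup E'] [NormedSpace ℝ E']
    {H' : Type*} [TopologicalSpace H'] {J : ModelWithCorners ℝ E' H'}
    {N : Type*} [TopologicalSpace N] [ChartedSpace H' N]
    {f : N → M} {σ τ : Π w, TangentSpace I (f w)} {w : N} (hf : MDifferentiableAt J I f w)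
    (hσ : MDifferentiableAt J I.tangent (fun w' => (⟨f w', σ w'⟩ : TangentBundle I M)) w)
    (hτ : MDifferentiableAt J I.tangent (fun w' => (⟨f w', τ w'⟩ : TangentBundle I M)) w) :
    MDifferentiableAt J 𝓘(ℝ, ℝ) (fun w => g.inner (f w) (σ w) (τ w)) w := by
  have : MDifferentiableAt J (I.prod 𝓘(ℝ))
      (fun m => TotalSpace.mk' ℝ (E := Bundle.Trivial M ℝ) (f m) (g.inner (f m) (σ m) (τ m))) w := by
    apply MDifferentiableAt.clm_bundle_apply₂ (F₁ := E) (F₂ := E)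
    · exact MDifferentiableAt.comp w (g.contMDiff.contMDiffAt.mdifferentiableAt (by simp)) hf
    · exact hσ
    · exact hτ
  simp only [mdifferentiableAt_totalSpace] at this
  exact this.2

end TangentConn

/-! ### The Koszul formula -/

namespace TangentConn

variable {E : Type*} [NormedAddCommGroup E] [NormedSpace ℝ E] [FiniteDimensional ℝ E]
  {H : Type*} [TopologicalSpace H] {I : ModelWithCorners ℝ E H}
  {M : Type*} [TopologicalSpace M] [ChartedSpace H M] [IsManifold I ∞ M]
  {g : ContMDiffRiemannianMetric I ∞ E (TangentSpace I : M → Type _)}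
  {D D' : CovariantDerivative I E (TangentSpace I : M → Type _)}
  {X Y Z : Π x : M, TangentSpace I x} {x : M}

theorem eq_of_forall_inner_eq
    (g : ContMDiffRiemannianMetric I ∞ E (TangentSpace I : M → Type _)) {v w : TangentSpace I x}
    (h : ∀ z, g.inner x v z = g.inner x w z) : v = w := by
  by_contra hne
  have h1 := g.pos x (v - w) (sub_ne_zero.2 hne)
  have h2 : g.inner x v = g.inner x w := by ext z; exact h z
  have h3 : g.inner x (v - w) = 0 := (map_sub (g.inner x) v w).trans (sub_eq_zero.2 h2)
  rw [h3] at h1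
  exact lt_irrefl _ h1

theorem IsLeviCivita.sub_eq_mlieBracket (hD : IsLeviCivita g D) (hX : MDiffAt (T% X) x)
    (hY : MDiffAt (T% Y) x) : D Y x (X x) - D X x (Y x) = mlieBracket I X Y x :=
  (D.torsion_eq_zero_iff.1 hD.1) hX hY

/-- Metricity expands the three derivatives, zero torsion turns brackets into differences of
covariant derivatives, and all but two terms cancel. The right side is free of `D`, whence
uniqueness and smoothness. -/
theorem IsLeviCivita.koszul (hD : IsLeviCivita g D) (hX : MDiffAt (T% X) x)
    (hY : MDiffAt (T% Y) x) (hZ : MDiffAt (T% Z) x) :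
    2 * g.inner x (D Y x (X x)) (Z x) =
      mvfderiv I (fun y => g.inner y (Y y) (Z y)) x (X x)
        + mvfderiv I (fun y => g.inner y (X y) (Z y)) x (Y x)
        - mvfderiv I (fun y => g.inner y (X y) (Y y)) x (Z x)
        + g.inner x (mlieBracket I X Y x) (Z x)
        - g.inner x (mlieBracket I X Z x) (Y x)
        - g.inner x (mlieBracket I Y Z x) (X x) := by
  rw [hD.2 x Y Z hY hZ, hD.2 x X Z hX hZ, hD.2 x X Y hX hY, ← hD.sub_eq_mlieBracket hX hY,
    ← hD.sub_eq_mlieBracket hX hZ, ← hD.sub_eq_mlieBracket hY hZ]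
  simp only [map_sub, sub_apply]
  rw [g.symm x (D Z x (X x)), g.symm x (D Z x (Y x)), g.symm x (D X x (Z x)) (Y x),
    g.symm x (D Y x (Z x)) (X x)]
  ring

/-- The Levi-Civita connection is unique on differentiable vector fields. -/
theorem IsLeviCivita.eq_of_mdifferentiableAt (hD : IsLeviCivita g D) (hD' : IsLeviCivita g D')
    (hY : MDiffAt (T% Y) x) (v : TangentSpace I x) : D Y x v = D' Y x v := by
  refine eq_of_forall_inner_eq g fun z => ?_
  -- The Koszul formula needs vector fields, but its left side sees only the values of the first and
  -- third at `x`, so any differentiable extensions serve.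
  have hv : MDiffAt (T% (extend E v)) x := mdifferentiableAt_extend I E v
  have hz : MDiffAt (T% (extend E z)) x := mdifferentiableAt_extend I E z
  have h := hD.koszul hv hY hz
  rw [← hD'.koszul hv hY hz, extend_apply_self, extend_apply_self] at h
  linarith

theorem contMDiffAt_mlieBracket (hX : CMDiffAt ∞ (T% X) x) (hY : CMDiffAt ∞ (T% Y) x) :
    CMDiffAt ∞ (T% (mlieBracket I X Y)) x := by
  have : IsManifold I ((⊤ : ℕ∞) + 1) M := ‹IsManifold I ∞ M›
  have : IsManifold I (minSmoothness ℝ 2) M := by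
    rw [minSmoothness_of_isRCLikeNormedField]; infer_instance
  exact ContMDiffAt.mlieBracket_vectorField (m := ⊤) (n := ⊤) hX hY (by simp)

/-- A smooth metric has smooth components in the preferred trivialization. -/
theorem exists_coord_metric (g : ContMDiffRiemannianMetric I ∞ E (TangentSpace I : M → Type _))
    (x : M) : ∃ G : M → E →L[ℝ] E →L[ℝ] ℝ,
      ContMDiffAt I 𝓘(ℝ, E →L[ℝ] E →L[ℝ] ℝ) ∞ G x ∧ ∀ y ∈ (chartAt H x).source, ∀ a b,
        G y a b = g.inner y (coordField x a y) (coordField x b y) := by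
  refine ⟨_, ((contMDiffAt_hom_bundle _).1 (g.contMDiff x)).2, fun y hy a b => ?_⟩
  have hy' : y ∈ (trivializationAt E (TangentSpace I : M → Type _) x).baseSet := hy
  refine (inCoordinates_apply_eq₂ (E₃ := Bundle.Trivial M ℝ) hy' hy' (Set.mem_univ _)).trans ?_
  simp [coordField, Trivialization.symmL_apply _ hy']

/-- The Levi-Civita connection of a smooth metric is smooth. -/
theorem IsLeviCivita.contMDiffCovariantDerivative (hD : IsLeviCivita g D) :
    D.ContMDiffCovariantDerivative ∞ where
  contMDiff := ⟨fun {Y} hY x _ => by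
    have hYx : ∀ y, CMDiffAt ∞ (T% Y) y := fun y => by
      have := hY y trivial
      exact this.contMDiffAt Filter.univ_mem
    refine ContMDiffAt.contMDiffWithinAt ?_
    refine contMDiffAt_hom_of_coord fun a => ?_
    have hs := mem_chart_source H x
    have hnhds : ∀ᶠ y in 𝓝 x, y ∈ (chartAt H x).source :=
      (chartAt H x).open_source.mem_nhds hs
    let e := trivializationAt E (TangentSpace I : M → Type _) x
    obtain ⟨G, hGs, hG⟩ := exists_coord_metric g x
    have hinv : ∀ y ∈ (chartAt H x).source, (G y).IsInvertible := fun y hy => by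
      have hinj : Function.Injective (G y).toLinearMap := by
        rw [injective_iff_map_eq_zero]
        intro a ha
        by_contra hne
        have h1 : coordField (I := I) x a y ≠ 0 := fun h0 => hne (by
          rw [← coord_coordField (I := I) hy a, h0, map_zero])
        have h2 := g.pos y _ h1
        rw [← hG y hy] at h2
        have h3 : G y a = 0 := ha
        rw [h3] at h2
        exact lt_irrefl _ h2
      have hfr : Module.finrank ℝ E = Module.finrank ℝ (E →L[ℝ] ℝ) := by
        rw [← (LinearMap.toContinuousLinearMap (𝕜 := ℝ) (E := E) (F' := ℝ)).finrank_eq]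
        exact (Subspace.dual_finrank_eq (K := ℝ) (V := E)).symm
      let L := LinearEquiv.ofInjectiveOfFinrankEq _ hinj hfr
      exact ⟨L.toContinuousLinearEquiv, by ext; rfl⟩
    -- `K` is the covector dual to ∇_a Y. The Koszul formula shows that its components are smooth,
    -- and `(G y).inverse` recovers the components of ∇_a Y from it.
    let K : M → E →L[ℝ] ℝ := fun y =>
      (g.inner y (D Y y (coordField x a y))).comp (e.symmL ℝ y)
    have hK : ∀ y c, K y c = g.inner y (D Y y (coordField x a y)) (coordField x c y) :=
      fun y c => rfl
    have hKs : ContMDiffAt I 𝓘(ℝ, E →L[ℝ] ℝ) ∞ K x := by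
      refine ContMDiffAt.of_clm_apply fun c => ?_
      have hX : CMDiffAt ∞ (T% (coordField (I := I) x a)) x := contMDiffAt_coordField hs a
      have hZ : CMDiffAt ∞ (T% (coordField (I := I) x c)) x := contMDiffAt_coordField hs c
      have hm : ∀ {U V : Π y : M, TangentSpace I y}, CMDiffAt ∞ (T% U) x → CMDiffAt ∞ (T% V) x →
          ContMDiffAt I 𝓘(ℝ, ℝ) ∞ (fun y => g.inner y (U y) (V y)) x :=
        fun hU hV => contMDiffAt_metric_apply g contMDiffAt_id hU hV
      have hrhs := (((((hm (hYx x) hZ).mvfderiv_apply hX (m := ∞) (by simp)).add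
        ((hm hX hZ).mvfderiv_apply (hYx x) (m := ∞) (by simp))).sub
        ((hm hX (hYx x)).mvfderiv_apply hZ (m := ∞) (by simp))).add
        (hm (contMDiffAt_mlieBracket hX (hYx x)) hZ)).sub
        (hm (contMDiffAt_mlieBracket hX hZ) (hYx x)) |>.sub
        (hm (contMDiffAt_mlieBracket (hYx x) hZ) hX)
      refine ((contMDiffAt_const (c := (1 / 2 : ℝ))).mul hrhs).congr_of_eventuallyEq ?_
      filter_upwards [hnhds] with y hy
      have := hD.koszul (mdifferentiableAt_coordField (I := I) hy a)
        ((hYx y).mdifferentiableAt (by simp)) (mdifferentiableAt_coordField (I := I) hy c)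
      change K y c = 1 / 2 * _
      rw [hK]
      simp only [Pi.add_apply]
      rw [← this]
      ring
    have hTK : (fun y => coord x y (D Y y (coordField x a y))) =ᶠ[𝓝 x]
        fun y => (G y).inverse (K y) := by
      filter_upwards [hnhds] with y hy
      have : K y = G y (coord x y (D Y y (coordField x a y))) := by
        ext c
        rw [hG y hy, coordField_coord hy, hK]
      rw [this, (hinv y hy).inverse_apply_self]
    refine ContMDiffAt.congr_of_eventuallyEq ?_ hTK
    obtain ⟨e', he'⟩ := hinv x hs
    -- Inversion of operators is smooth at an invertible one.
    have h1 : ContMDiffAt I 𝓘(ℝ, (E →L[ℝ] ℝ) →L[ℝ] E) ∞ (fun y => (G y).inverse) x := by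
      have h2 : ContDiffAt ℝ ∞ ContinuousLinearMap.inverse (G x) := by
        rw [← he']; exact contDiffAt_map_inverse e'
      exact h2.contMDiffAt.comp x hGs
    exact h1.clm_apply hKs⟩

end TangentConn

/-! ### Connection coefficients and pull-back connections -/

section Calculus

variable {E : Type*} [NormedAddCommGroup E] [NormedSpace ℝ E]
  {H : Type*} [TopologicalSpace H] {I : ModelWithCorners ℝ E H}
  {M : Type*} [TopologicalSpace M] [ChartedSpace H M]
  {E' : Type*} [NormedAddCommGroup E'] [NormedSpace ℝ E']
  {H' : Type*} [TopologicalSpace H'] {J : ModelWithCorners ℝ E' H'}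
  {N : Type*} [TopologicalSpace N] [ChartedSpace H' N]
  {F : Type*} [NormedAddCommGroup F] [NormedSpace ℝ F]
  {F' : Type*} [NormedAddCommGroup F'] [NormedSpace ℝ F']

theorem mvfderiv_clm_apply {A : M → F →L[ℝ] F'} {b : M → F} {x : M}
    (hA : MDifferentiableAt I 𝓘(ℝ, F →L[ℝ] F') A x) (hb : MDifferentiableAt I 𝓘(ℝ, F) b x)
    (v : TangentSpace I x) :
    mvfderiv I (fun y => A y (b y)) x v = mvfderiv I A x v (b x) + A x (mvfderiv I b x v) := by
  let A' : E →L[ℝ] F →L[ℝ] F' := mvfderiv I A x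
  let b' : E →L[ℝ] F := mvfderiv I b x
  let L : E →L[ℝ] F' := (A x).comp b' + A'.flip (b x)
  have h : HasMFDerivAt I 𝓘(ℝ, F') (fun y => A y (b y)) x L := by
    refine ⟨(hA.clm_apply hb).continuousAt, ?_⟩
    -- The targets are vector spaces with identity charts, so in the chart at `x` this is the
    -- ordinary product rule.
    have h1 := HasFDerivWithinAt.clm_apply (c' := A') (u' := b') hA.hasMFDerivAt.2
      hb.hasMFDerivAt.2
    simp only [writtenInExtChartAt, extChartAt_model_space_eq_id, PartialEquiv.refl_coe,
      Function.comp_def, id_eq, extChartAt_to_inv] at h1 ⊢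
    exact h1
  have h2 : mvfderiv I (fun y => A y (b y)) x v = L v := DFunLike.congr_fun h.mfderiv v
  rw [h2, add_comm]
  rfl

theorem mvfderiv_comp_vector {f : N → M} {h : M → F} {w : N}
    (hh : MDifferentiableAt I 𝓘(ℝ, F) h (f w)) (hf : MDifferentiableAt J I f w)
    (v : TangentSpace J w) :
    mvfderiv J (fun w' => h (f w')) w v = mvfderiv I h (f w) (mfderiv J I f w v) :=
  mfderiv_comp_apply w hh hf v

theorem Filter.EventuallyEq.mvfderiv_eq {h h' : M → F} {x : M} (hh : h =ᶠ[𝓝 x] h') :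
    mvfderiv I h x = mvfderiv I h' x := by
  have := hh.mfderiv_eq (I := I) (I' := 𝓘(ℝ, F))
  exact this

end Calculus

namespace TangentConn

variable {E : Type*} [NormedAddCommGroup E] [NormedSpace ℝ E] [FiniteDimensional ℝ E]
  {H : Type*} [TopologicalSpace H] {I : ModelWithCorners ℝ E H}
  {M : Type*} [TopologicalSpace M] [ChartedSpace H M] [IsManifold I ∞ M]
  {D : CovariantDerivative I E (TangentSpace I : M → Type _)}
  {x y : M}

open Classical in
/-- The connection coefficients of `D` in the preferred trivialization at `x`, as a bilinear map
of the components of the section and of the direction. -/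
def christoffel (D : CovariantDerivative I E (TangentSpace I : M → Type _)) (x y : M) :
    E →L[ℝ] E →L[ℝ] E :=
  if hy : y ∈ (chartAt H x).source then
    LinearMap.toContinuousLinearMap
      { toFun := fun c => ((coord x y).comp (D (coordField x c) y)).comp
          ((trivializationAt E (TangentSpace I : M → Type _) x).symmL ℝ y)
        map_add' := fun c c' => by
          rw [coordField_add, D.isCovariantDerivativeOn.add (mdifferentiableAt_coordField hy c)
            (mdifferentiableAt_coordField hy c') (Set.mem_univ y)]
          ext; simp
        map_smul' := fun r c => by
          rw [coordField_smul, D.isCovariantDerivativeOn.smul_const r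
            (mdifferentiableAt_coordField hy c) (Set.mem_univ y)]
          ext; simp }
  -- A filler value: off the chart domain the coordinate fields are not known to be differentiable,
  -- so linearity in the section is unavailable.
  else 0

theorem christoffel_apply (hy : y ∈ (chartAt H x).source) (c a : E) :
    christoffel D x y c a = coord x y (D (coordField x c) y (coordField x a y)) := by
  rw [christoffel, dif_pos hy]
  rfl

/-- Multiplication by a bump function supported in `s`. Smoothness of a connection is a condition on
globally smooth sections, whereas coordinate fields are smooth only on a chart domain. -/
theorem exists_contMDiff_section_eventuallyEq [T2Space M] {σ : Π y : M, TangentSpace I y}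
    {s : Set M} (hs : IsOpen s) (hσ : ∀ y ∈ s, CMDiffAt ∞ (T% σ) y) (hy : y ∈ s) :
    ∃ τ : Π y : M, TangentSpace I y, ContMDiff I I.tangent ∞ (T% τ) ∧ ∀ᶠ z in 𝓝 y, τ z = σ z := by
  obtain ⟨ψ, -, hψ⟩ := (SmoothBumpFunction.nhds_basis_tsupport (I := I) y).mem_iff.1
    (hs.mem_nhds hy)
  refine ⟨fun z => ψ z • σ z, ?_, ?_⟩
  · exact ContMDiffOn.smul_section_of_tsupport (V := (TangentSpace I : M → Type _))
      ψ.contMDiff.contMDiffOn hs hψ (fun z hz => (hσ z hz).contMDiffWithinAt)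
  · filter_upwards [ψ.eventuallyEq_one] with z hz
    simp [hz]

theorem contMDiffAt_covariantDerivative_apply [T2Space M] (hD : D.ContMDiffCovariantDerivative ∞)
    {σ τ : Π y : M, TangentSpace I y} {s : Set M} (hs : IsOpen s)
    (hσ : ∀ y ∈ s, CMDiffAt ∞ (T% σ) y) (hy : y ∈ s) (hτ : CMDiffAt ∞ (T% τ) y) :
    CMDiffAt ∞ (T% (fun z => D σ z (τ z))) y := by
  obtain ⟨σ', hσ', he⟩ := exists_contMDiff_section_eventuallyEq hs hσ hy
  have h1 : ContMDiffAt I (I.prod 𝓘(ℝ, E →L[ℝ] E)) ∞ (fun z => TotalSpace.mk' (E →L[ℝ] E)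
      (E := fun z => TangentSpace I z →L[ℝ] TangentSpace I z) z (D σ' z)) y :=
    (hD.contMDiff.contMDiff (σ := σ') hσ'.contMDiffOn y trivial).contMDiffAt Filter.univ_mem
  have h2 : CMDiffAt ∞ (T% (fun z => D σ' z (τ z))) y := h1.clm_bundle_apply hτ
  refine h2.congr_of_eventuallyEq ?_
  filter_upwards [he.eventually_nhds, hs.mem_nhds hy] with z hz hzs
  -- Locality of the connection, applied at every `z` near `y`; hence the eventual equality is first
  -- spread to neighbourhoods of such `z`.
  have : D σ z = D σ' z := D.isCovariantDerivativeOn.congr_of_eventuallyEq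
    ((hσ z hzs).mdifferentiableAt (by simp)) (hσ' z |>.mdifferentiableAt (by simp)) Filter.univ_mem
    (hz.mono fun _ h => h.symm)
  rw [this]

theorem contMDiffAt_christoffel [T2Space M] (hD : D.ContMDiffCovariantDerivative ∞)
    (hy : y ∈ (chartAt H x).source) :
    ContMDiffAt I 𝓘(ℝ, E →L[ℝ] E →L[ℝ] E) ∞ (christoffel D x) y := by
  refine ContMDiffAt.of_clm_apply fun c => ContMDiffAt.of_clm_apply fun a => ?_
  have h := (contMDiffAt_along_iff (f := id) contMDiffAt_id hy).1
    (contMDiffAt_covariantDerivative_apply hD (chartAt H x).open_source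
      (fun z hz => contMDiffAt_coordField hz c) hy (contMDiffAt_coordField hy a))
  refine h.congr_of_eventuallyEq ?_
  filter_upwards [(chartAt H x).open_source.mem_nhds hy] with z hz
  exact christoffel_apply hz c a

theorem mdifferentiableAt_coord_section {σ : Π y : M, TangentSpace I y}
    (hσ : MDiffAt (T% σ) y) (hy : y ∈ (chartAt H x).source) :
    MDifferentiableAt I 𝓘(ℝ, E) (fun z => coord x z (σ z)) y :=
  (mdifferentiableAt_along_iff (f := id) mdifferentiableAt_id hy).1 hσ

/-- The flat connection of the preferred trivialization at `x`. -/
theorem isCovariantDerivativeOn_flat (x : M) :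
    IsCovariantDerivativeOn E
      (fun (σ : Π y : M, TangentSpace I y) y =>
        ((trivializationAt E (TangentSpace I : M → Type _) x).symmL ℝ y).comp
          (mvfderiv I (fun z => coord x z (σ z)) y))
      (chartAt H x).source where
  add {σ σ' y} hσ hσ' hy := by
    have h : (fun z => coord x z ((σ + σ') z)) =
      fun z => coord x z (σ z) + coord x z (σ' z) := by funext z; simp
    rw [h, mvfderiv_fun_add (mdifferentiableAt_coord_section hσ hy)
      (mdifferentiableAt_coord_section hσ' hy), ContinuousLinearMap.comp_add]
  leibniz {σ r y} hσ hr hy := by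
    have h : (fun z => coord x z ((r • σ) z)) =
      fun z => r z • coord x z (σ z) := by funext z; simp
    rw [h, mvfderiv_fun_smul hr (mdifferentiableAt_coord_section hσ hy)]
    ext v
    have := coordField_coord hy (σ y)
    simp only [coordField] at this
    simp [this]

/-- The components of a covariant derivative. -/
theorem coord_covariantDerivative {σ : Π y : M, TangentSpace I y} (hσ : MDiffAt (T% σ) y)
    (hy : y ∈ (chartAt H x).source) (v : TangentSpace I y) :
    coord x y (D σ y v) = mvfderiv I (fun z => coord x z (σ z)) y v
      + christoffel D x y (coord x y (σ y)) (coord x y v) := by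
  have hD := D.isCovariantDerivativeOn (s := (chartAt H x).source)
  have h0 := isCovariantDerivativeOn_flat (I := I) x
  have hs := mdifferentiableAt_coordField (I := I) hy (coord x y (σ y))
  -- The difference from the flat connection is tensorial, so `σ` may be replaced by the coordinate
  -- field with the same value at `y`, which the flat connection annihilates (`h4`).
  have h1 := IsCovariantDerivativeOn.difference_apply hD h0 hy hσ
  have h2 := IsCovariantDerivativeOn.difference_apply hD h0 hy hs
  rw [coordField_coord hy] at h2
  have h3 := DFunLike.congr_fun (h1.symm.trans h2) v
  have h4 : mvfderiv I (fun z => coord x z (coordField (I := I) x (coord x y (σ y)) z)) y = 0 := by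
    rw [Filter.EventuallyEq.mvfderiv_eq (h' := fun _ => coord x y (σ y)), mvfderiv_const]
    filter_upwards [(chartAt H x).open_source.mem_nhds hy] with z hz
    exact coord_coordField hz _
  rw [h4] at h3
  simp only [sub_apply, ContinuousLinearMap.comp_zero, sub_zero,
    ContinuousLinearMap.comp_apply] at h3
  rw [sub_eq_iff_eq_add] at h3
  rw [h3, map_add, christoffel_apply hy, coordField_coord hy, add_comm]
  congr 1
  exact coord_coordField hy _

section Pullback

variable {E' : Type*} [NormedAddCommGroup E'] [NormedSpace ℝ E']
  {H' : Type*} [TopologicalSpace H'] {J : ModelWithCorners ℝ E' H'}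
  {N : Type*} [TopologicalSpace N] [ChartedSpace H' N]
  {f : N → M} {σ τ : Π w, TangentSpace I (f w)} {w : N}

/-- The components of the pull-back connection in an arbitrary preferred trivialization. -/
theorem coord_pullbackConnection (hf : MDifferentiableAt J I f w)
    (hσ : MDifferentiableAt J I.tangent (fun w' => (⟨f w', σ w'⟩ : TangentBundle I M)) w)
    (hw : f w ∈ (chartAt H x).source) (v : TangentSpace J w) :
    coord x (f w) (pullbackConnection J D f σ w v) =
      mvfderiv J (fun w' => coord x (f w') (σ w')) w v
        + christoffel D x (f w) (coord x (f w) (σ w)) (coord x (f w) (mfderiv J I f w v)) := by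
  have hx := mem_chart_source H (f w)
  set c : E := coord (f w) (f w) (σ w)
  have h1 : pullbackConnection J D f σ w v =
      coordField (f w) (mvfderiv J (fun w' => coord (f w) (f w') (σ w')) w v) (f w)
        + D (coordField (f w) c) (f w) (mfderiv J I f w v) := by
    have h2 : D (extend E (σ w)) (f w) = D (coordField (f w) c) (f w) :=
      D.isCovariantDerivativeOn.congr_of_eventuallyEq (mdifferentiableAt_extend I E _)
        (mdifferentiableAt_coordField hx _) Filter.univ_mem (extend_eventuallyEq _)
    rw [(eventually_coord_eq hf.continuousAt hx).mvfderiv_eq, ← h2]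
    rfl
  -- `T` is the transition function from the trivialization at `f w`, in which the pull-back
  -- connection is defined, to the one at `x`. Its derivative enters both through the product rule
  -- and through the derivative of the coordinate field (`h5`), and the two occurrences agree.
  let T : M → E →L[ℝ] E := fun y => (coord x y).comp
    ((trivializationAt E (TangentSpace I : M → Type _) (f w)).symmL ℝ y)
  have hT : MDifferentiableAt I 𝓘(ℝ, E →L[ℝ] E) T (f w) := by
    have : ContMDiffAt I 𝓘(ℝ, E →L[ℝ] E) ∞ T (f w) := ContMDiffAt.of_clm_apply fun a =>
      (contMDiffAt_along_iff (f := id) contMDiffAt_id hw).1 (contMDiffAt_coordField hx a)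
    exact this.mdifferentiableAt (by simp)
  have hσ1 := (mdifferentiableAt_along_iff hf hx).1 hσ
  have h3 : (fun w' => coord x (f w') (σ w')) =ᶠ[𝓝 w]
      fun w' => T (f w') (coord (f w) (f w') (σ w')) := by
    filter_upwards [hf.continuousAt.eventually ((chartAt H (f w)).open_source.mem_nhds hx)]
      with w' hw'
    exact congrArg _ (coordField_coord hw' _).symm
  have hTf : MDifferentiableAt J 𝓘(ℝ, E →L[ℝ] E) (fun w' => T (f w')) w := hT.comp w hf
  rw [h1, map_add, coord_covariantDerivative (mdifferentiableAt_coordField hx c) hw, h3.mvfderiv_eq,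
    mvfderiv_clm_apply hTf hσ1, mvfderiv_comp_vector hT hf, coordField_coord hx]
  have h4 := mvfderiv_clm_apply (b := fun _ => c) hT mdifferentiableAt_const (mfderiv J I f w v)
  rw [mvfderiv_const] at h4
  simp only [zero_apply, map_zero, add_zero] at h4
  have h5 : mvfderiv I (fun z => coord x z (coordField (f w) c z)) (f w) (mfderiv J I f w v) =
    mvfderiv I T (f w) (mfderiv J I f w v) c := h4
  rw [h5]
  change T (f w) _ + (_ + _) = _
  abel

end Pullback

end TangentConn

/-! ### Structure equations of a pull-back connection -/

namespace TangentConn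

variable {E : Type*} [NormedAddCommGroup E] [NormedSpace ℝ E] [FiniteDimensional ℝ E]
  {H : Type*} [TopologicalSpace H] {I : ModelWithCorners ℝ E H}
  {M : Type*} [TopologicalSpace M] [ChartedSpace H M] [IsManifold I ∞ M]
  {D : CovariantDerivative I E (TangentSpace I : M → Type _)}
  {x y : M}
  {E' : Type*} [NormedAddCommGroup E'] [NormedSpace ℝ E']
  {H' : Type*} [TopologicalSpace H'] {J : ModelWithCorners ℝ E' H'}
  {N : Type*} [TopologicalSpace N] [ChartedSpace H' N]
  {f : N → M} {σ τ : Π w, TangentSpace I (f w)} {w : N} {X Y : Π w : N, TangentSpace J w}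

theorem two_le_infty : (2 : ℕ∞ω) ≤ ∞ :=
  WithTop.coe_le_coe.2 (le_top : (2 : ℕ∞) ≤ ⊤)

/-- The tangent bundle is trivialized by the differentials of charts. Components of df(X) thus
become derivatives of the chart expression of f, to which the commutator formula for brackets
applies. -/
theorem coord_eq_mvfderiv (hy : y ∈ (chartAt H x).source) (v : TangentSpace I y) :
    coord x y v = mvfderiv I (extChartAt I x) y v :=
  DFunLike.congr_fun (TangentBundle.continuousLinearMapAt_trivializationAt hy) v

theorem contMDiffAt_chart_comp {n : ℕ∞ω} [IsManifold I n M] (hf : ContMDiffAt J I n f w)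
    (hw : f w ∈ (chartAt H x).source) :
    ContMDiffAt J 𝓘(ℝ, E) n (fun w' => extChartAt I x (f w')) w :=
  (contMDiffAt_extChartAt' hw).comp w hf

theorem eventually_mdifferentiableAt [IsManifold J ∞ N] (hf : ContMDiffAt J I ∞ f w) :
    ∀ᶠ w' in 𝓝 w, MDifferentiableAt J I f w' := by
  have h := (contMDiffAt_iff_contMDiffAt_nhds (by simp)).1
    (hf.of_le (by simp : (1 : ℕ∞ω) ≤ ∞))
  exact h.mono fun w' hw' => hw'.mdifferentiableAt one_ne_zero

theorem coord_mfderiv (hf : MDifferentiableAt J I f w) (hw : f w ∈ (chartAt H x).source)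
    (v : TangentSpace J w) :
    coord x (f w) (mfderiv J I f w v) = mvfderiv J (fun w' => extChartAt I x (f w')) w v := by
  rw [coord_eq_mvfderiv hw]
  exact (mvfderiv_comp_vector (mdifferentiableAt_extChartAt hw) hf v).symm

theorem eventually_coord_mfderiv [IsManifold J ∞ N] (hf : ContMDiffAt J I ∞ f w)
    (hw : f w ∈ (chartAt H x).source) :
    (fun w' => coord x (f w') (mfderiv J I f w' (Y w'))) =ᶠ[𝓝 w]
      fun w' => mvfderiv J (fun w' => extChartAt I x (f w')) w' (Y w') := by
  filter_upwards [eventually_mdifferentiableAt hf,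
    hf.continuousAt.eventually ((chartAt H x).open_source.mem_nhds hw)] with w' h1 h2
  exact coord_mfderiv h1 h2 _

theorem mdifferentiableAt_mfderiv_apply [IsManifold J ∞ N] (hf : ContMDiffAt J I ∞ f w)
    (hY : MDiffAt (T% Y) w) :
    MDifferentiableAt J I.tangent
      (fun w' => (⟨f w', mfderiv J I f w' (Y w')⟩ : TangentBundle I M)) w := by
  have hw := mem_chart_source H (f w)
  rw [mdifferentiableAt_along_iff (hf.mdifferentiableAt (by simp)) hw,
    (eventually_coord_mfderiv hf hw).mdifferentiableAt_iff]
  exact MDifferentiableAt.mvfderiv_apply ((contMDiffAt_chart_comp hf hw).of_le two_le_infty) hY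

theorem contMDiffAt_mfderiv_apply [IsManifold J ∞ N] (hf : ContMDiffAt J I ∞ f w)
    (hY : CMDiffAt ∞ (T% Y) w) :
    ContMDiffAt J I.tangent ∞
      (fun w' => (⟨f w', mfderiv J I f w' (Y w')⟩ : TangentBundle I M)) w := by
  have hw := mem_chart_source H (f w)
  rw [contMDiffAt_along_iff hf hw, (eventually_coord_mfderiv hf hw).contMDiffAt_iff]
  exact ContMDiffAt.mvfderiv_apply (contMDiffAt_chart_comp hf hw) hY (by simp)

/-- The chart has constant derivative along coordinate fields, so the commutator annihilates it, and
the differential of a chart is injective. -/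
theorem mlieBracket_coordField [I.Boundaryless] (x : M) (a b : E) :
    mlieBracket I (coordField x a) (coordField (I := I) x b) x = 0 := by
  have hx := mem_chart_source H x
  have hc : ∀ c : E, mvfderiv I (fun y => mvfderiv I (extChartAt I x) y (coordField x c y)) x = 0 :=
    fun c => by
    rw [Filter.EventuallyEq.mvfderiv_eq (h' := fun _ => c), mvfderiv_const]
    filter_upwards [(chartAt H x).open_source.mem_nhds hx] with z hz
    rw [← coord_eq_mvfderiv hz, coord_coordField hz]
  refine coord_injective hx ?_
  rw [coord_eq_mvfderiv hx, mvfderiv_mlieBracket (contMDiffAt_extChartAt (n := 2))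
    (mdifferentiableAt_coordField hx a) (mdifferentiableAt_coordField hx b), hc, hc]
  simp

theorem coord_torsion [I.Boundaryless] (x : M) (v w : TangentSpace I x) :
    coord x x (D.torsion x v w) =
      christoffel D x x (coord x x w) (coord x x v)
        - christoffel D x x (coord x x v) (coord x x w) := by
  have hx := mem_chart_source H x
  have h := D.torsion_apply (mdifferentiableAt_coordField (I := I) hx (coord x x v))
    (mdifferentiableAt_coordField (I := I) hx (coord x x w))
  rw [mlieBracket_coordField, sub_zero] at h
  rw [christoffel_apply hx, christoffel_apply hx, ← map_sub, ← h]
  simp only [coordField_coord hx]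

/-- The structure equation for the torsion of a pull-back connection. -/
theorem pullbackConnection_torsion [I.Boundaryless] [FiniteDimensional ℝ E'] [J.Boundaryless]
    [IsManifold J ∞ N] (hf : ContMDiffAt J I ∞ f w) (hX : MDiffAt (T% X) w)
    (hY : MDiffAt (T% Y) w) :
    pullbackConnection J D f (fun w' => mfderiv J I f w' (Y w')) w (X w)
      - pullbackConnection J D f (fun w' => mfderiv J I f w' (X w')) w (Y w)
      - mfderiv J I f w (mlieBracket J X Y w) =
    D.torsion (f w) (mfderiv J I f w (X w)) (mfderiv J I f w (Y w)) := by
  have hw := mem_chart_source H (f w)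
  have hfd := hf.mdifferentiableAt (by simp)
  refine coord_injective hw ?_
  -- The second derivatives of the chart expression of `f` cancel against the bracket term; the
  -- alternated connection coefficients remain.
  rw [coord_torsion, map_sub, map_sub,
    coord_pullbackConnection hfd (mdifferentiableAt_mfderiv_apply hf hY) hw,
    coord_pullbackConnection hfd (mdifferentiableAt_mfderiv_apply hf hX) hw,
    (eventually_coord_mfderiv hf hw).mvfderiv_eq, (eventually_coord_mfderiv hf hw).mvfderiv_eq,
    coord_mfderiv hfd hw (mlieBracket J X Y w),
    mvfderiv_mlieBracket ((contMDiffAt_chart_comp hf hw).of_le two_le_infty) hX hY]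
  abel

/-- The components of the curvature tensor in terms of the connection coefficients. -/
def curvatureCoord (D : CovariantDerivative I E (TangentSpace I : M → Type _)) (x : M)
    (v v' : TangentSpace I x) (c : E) : E :=
  mvfderiv I (christoffel D x) x v c (coord x x v')
    - mvfderiv I (christoffel D x) x v' c (coord x x v)
    + christoffel D x x (christoffel D x x c (coord x x v')) (coord x x v)
    - christoffel D x x (christoffel D x x c (coord x x v)) (coord x x v')

/-! ### Second covariant derivatives along a map and the curvature tensor -/

section Curvature

theorem eventually_coord_pullbackConnection [IsManifold J ∞ N] (hf : ContMDiffAt J I ∞ f w)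
    (hσ : ContMDiffAt J I.tangent ∞ (fun w' => (⟨f w', σ w'⟩ : TangentBundle I M)) w)
    (hw : f w ∈ (chartAt H x).source) (Y : Π w : N, TangentSpace J w) :
    (fun w' => coord x (f w') (pullbackConnection J D f σ w' (Y w'))) =ᶠ[𝓝 w]
      fun w' => mvfderiv J (fun w' => coord x (f w') (σ w')) w' (Y w')
        + christoffel D x (f w') (coord x (f w') (σ w'))
          (mvfderiv J (fun w' => extChartAt I x (f w')) w' (Y w')) := by
  filter_upwards [eventually_mdifferentiableAt hf, eventually_mdifferentiableAt hσ,
    hf.continuousAt.eventually ((chartAt H x).open_source.mem_nhds hw)] with w' h1 h2 h3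
  rw [coord_pullbackConnection h1 h2 h3, coord_mfderiv h1 h3]

variable [T2Space M]

theorem contMDiffAt_pullbackConnection [IsManifold J ∞ N] (hD : D.ContMDiffCovariantDerivative ∞)
    (hf : ContMDiffAt J I ∞ f w)
    (hσ : ContMDiffAt J I.tangent ∞ (fun w' => (⟨f w', σ w'⟩ : TangentBundle I M)) w)
    (hY : CMDiffAt ∞ (T% Y) w) :
    ContMDiffAt J I.tangent ∞
      (fun w' => (⟨f w', pullbackConnection J D f σ w' (Y w')⟩ : TangentBundle I M)) w := by
  have hw := mem_chart_source H (f w)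
  rw [contMDiffAt_along_iff hf hw, (eventually_coord_pullbackConnection hf hσ hw Y).contMDiffAt_iff]
  have hS := (contMDiffAt_along_iff hf hw).1 hσ
  exact (hS.mvfderiv_apply hY (by simp)).add
    ((((contMDiffAt_christoffel hD hw).comp w hf).clm_apply hS).clm_apply
      ((contMDiffAt_chart_comp hf hw).mvfderiv_apply hY (by simp)))

theorem mdifferentiableAt_pullbackConnection [IsManifold J ∞ N]
    (hD : D.ContMDiffCovariantDerivative ∞) (hf : ContMDiffAt J I ∞ f w)
    (hσ : ContMDiffAt J I.tangent ∞ (fun w' => (⟨f w', σ w'⟩ : TangentBundle I M)) w)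
    (hY : MDiffAt (T% Y) w) :
    MDifferentiableAt J I.tangent
      (fun w' => (⟨f w', pullbackConnection J D f σ w' (Y w')⟩ : TangentBundle I M)) w := by
  have hw := mem_chart_source H (f w)
  rw [mdifferentiableAt_along_iff (hf.mdifferentiableAt (by simp)) hw,
    (eventually_coord_pullbackConnection hf hσ hw Y).mdifferentiableAt_iff]
  have hS := (contMDiffAt_along_iff hf hw).1 hσ
  have hG := ((contMDiffAt_christoffel hD hw).comp w hf).mdifferentiableAt (by simp)
  exact (MDifferentiableAt.mvfderiv_apply (hS.of_le two_le_infty) hY).add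
    ((hG.clm_apply (hS.mdifferentiableAt (by simp))).clm_apply
      (MDifferentiableAt.mvfderiv_apply ((contMDiffAt_chart_comp hf hw).of_le two_le_infty) hY))

theorem mvfderiv_coord_pullbackConnection [IsManifold J ∞ N]
    (hD : D.ContMDiffCovariantDerivative ∞) (hf : ContMDiffAt J I ∞ f w)
    (hσ : ContMDiffAt J I.tangent ∞ (fun w' => (⟨f w', σ w'⟩ : TangentBundle I M)) w)
    (hw : f w ∈ (chartAt H x).source) (hY : MDiffAt (T% Y) w) (v : TangentSpace J w) :
    mvfderiv J (fun w' => coord x (f w') (pullbackConnection J D f σ w' (Y w'))) w v =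
      mvfderiv J (fun w' => mvfderiv J (fun w' => coord x (f w') (σ w')) w' (Y w')) w v
      + mvfderiv I (christoffel D x) (f w) (mfderiv J I f w v) (coord x (f w) (σ w))
          (mvfderiv J (fun w' => extChartAt I x (f w')) w (Y w))
      + christoffel D x (f w) (mvfderiv J (fun w' => coord x (f w') (σ w')) w v)
          (mvfderiv J (fun w' => extChartAt I x (f w')) w (Y w))
      + christoffel D x (f w) (coord x (f w) (σ w))
          (mvfderiv J (fun w' => mvfderiv J (fun w' => extChartAt I x (f w')) w' (Y w')) w v) := by
  have hfd := hf.mdifferentiableAt (by simp)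
  have hS := (contMDiffAt_along_iff hf hw).1 hσ
  have hSd := hS.mdifferentiableAt (by simp)
  have hΓ := (contMDiffAt_christoffel hD hw).mdifferentiableAt (by simp)
  have hG : MDifferentiableAt J 𝓘(ℝ, E →L[ℝ] E →L[ℝ] E) (fun w' => christoffel D x (f w')) w :=
    hΓ.comp w hfd
  have hSY := MDifferentiableAt.mvfderiv_apply (hS.of_le two_le_infty) hY
  have hFY := MDifferentiableAt.mvfderiv_apply
    ((contMDiffAt_chart_comp hf hw).of_le two_le_infty) hY
  have hGS := hG.clm_apply hSd
  rw [(eventually_coord_pullbackConnection hf hσ hw Y).mvfderiv_eq,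
    mvfderiv_fun_add hSY (hGS.clm_apply hFY), add_apply, mvfderiv_clm_apply hGS hFY,
    mvfderiv_clm_apply hG hSd, mvfderiv_comp_vector hΓ hfd]
  simp only [add_apply]
  abel

/-- The components of the commutator of covariant derivatives along a map. -/
theorem coord_pullbackConnection_commutator [FiniteDimensional ℝ E'] [J.Boundaryless]
    [IsManifold J ∞ N] (hD : D.ContMDiffCovariantDerivative ∞) (hf : ContMDiffAt J I ∞ f w)
    (hσ : ContMDiffAt J I.tangent ∞ (fun w' => (⟨f w', σ w'⟩ : TangentBundle I M)) w)
    (hX : MDiffAt (T% X) w) (hY : MDiffAt (T% Y) w) :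
    coord (f w) (f w)
      (pullbackConnection J D f (fun w' => pullbackConnection J D f σ w' (Y w')) w (X w)
        - pullbackConnection J D f (fun w' => pullbackConnection J D f σ w' (X w')) w (Y w)
        - pullbackConnection J D f σ w (mlieBracket J X Y w)) =
      curvatureCoord D (f w) (mfderiv J I f w (X w)) (mfderiv J I f w (Y w))
        (coord (f w) (f w) (σ w)) := by
  have hw := mem_chart_source H (f w)
  have hfd := hf.mdifferentiableAt (by simp)
  have hσd := hσ.mdifferentiableAt (by simp)
  have hS := (contMDiffAt_along_iff hf hw).1 hσ
  rw [map_sub, map_sub,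
    coord_pullbackConnection hfd (mdifferentiableAt_pullbackConnection hD hf hσ hY) hw,
    coord_pullbackConnection hfd (mdifferentiableAt_pullbackConnection hD hf hσ hX) hw,
    coord_pullbackConnection hfd hσd hw, mvfderiv_coord_pullbackConnection hD hf hσ hw hY,
    mvfderiv_coord_pullbackConnection hD hf hσ hw hX,
    coord_pullbackConnection hfd hσd hw, coord_pullbackConnection hfd hσd hw,
    mvfderiv_mlieBracket (hS.of_le two_le_infty) hX hY, coord_mfderiv hfd hw (mlieBracket J X Y w),
    mvfderiv_mlieBracket ((contMDiffAt_chart_comp hf hw).of_le two_le_infty) hX hY, curvatureCoord,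
    coord_mfderiv hfd hw, coord_mfderiv hfd hw]
  -- Second derivatives of `σ` and of `f` have become bracket terms and cancel. Terms with one
  -- coefficient and one first derivative of `σ` cancel in pairs, which leaves `curvatureCoord`.
  simp only [map_add, map_sub, add_apply]
  abel

theorem pullbackConnection_id {σ : Π y : M, TangentSpace I y} (hσ : MDiffAt (T% σ) x) :
    pullbackConnection I D id σ x = D σ x := by
  have hx := mem_chart_source H x
  ext v
  refine coord_injective hx ?_
  rw [coord_covariantDerivative hσ hx]
  refine (coord_pullbackConnection (f := id) mdifferentiableAt_id hσ hx v).trans ?_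
  rw [mfderiv_id]
  rfl

/-- The commutator formula along the identity map, applied to the extensions in the definition. It
shows that `curvature`, defined through chosen extensions, is a tensor; its symmetries are read off
from the coordinate expression. -/
theorem coord_curvature [I.Boundaryless] (hD : D.ContMDiffCovariantDerivative ∞)
    (x : M) (a b c : TangentSpace I x) :
    coord x x (curvature D x a b c) = curvatureCoord D x a b (coord x x c) := by
  have hs : ∀ v : TangentSpace I x, CMDiffAt ∞ (T% (extend E v)) x :=
    fun v => contMDiffAt_extend I E v
  have hd : ∀ v : TangentSpace I x, MDiffAt (T% (extend E v)) x :=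
    fun v => mdifferentiableAt_extend I E v
  let s : Π y : M, TangentSpace I y := extend E c
  have hev : ∀ b : TangentSpace I x, ∀ᶠ y in 𝓝 x,
      D (extend E c) y (extend E b y) =
        pullbackConnection I D id s y (extend E b y) := fun b =>
    (eventually_mdifferentiableAt (hs c)).mono fun y hy => by rw [pullbackConnection_id hy]
  have hpd : ∀ b : TangentSpace I x, MDiffAt (T% (fun y =>
      pullbackConnection I D id s y (extend E b y))) x := fun b =>
    mdifferentiableAt_pullbackConnection (f := id) hD contMDiffAt_id (hs c) (hd b)
  have hpd' : ∀ b : TangentSpace I x, MDiffAt (T% (fun y =>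
      D (extend E c) y (extend E b y))) x := fun b => by
    refine (hpd b).congr_of_eventuallyEq ((hev b).mono fun y hy => ?_)
    simp only [hy]
  have key : ∀ a b : TangentSpace I x, D (fun y => D (extend E c) y (extend E b y)) x a =
      pullbackConnection I D id (fun y =>
        pullbackConnection I D id s y (extend E b y)) x a := fun a b => by
    rw [pullbackConnection_id (hpd b)]
    exact DFunLike.congr_fun (D.isCovariantDerivativeOn.congr_of_eventuallyEq (hpd' b) (hpd b)
      Filter.univ_mem (hev b)) a
  have h := coord_pullbackConnection_commutator (f := id) hD contMDiffAt_id (hs c) (hd a) (hd b)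
  rw [curvature, key, key, ← pullbackConnection_id (hd c)]
  simp only [extend_apply_self] at h
  refine h.trans ?_
  rw [mfderiv_id]
  rfl

/-- The structure equation for the curvature of a pull-back connection. -/
theorem pullbackConnection_curvature [I.Boundaryless] [FiniteDimensional ℝ E'] [J.Boundaryless]
    [IsManifold J ∞ N] (hD : D.ContMDiffCovariantDerivative ∞) (hf : ContMDiffAt J I ∞ f w)
    (hσ : ContMDiffAt J I.tangent ∞ (fun w' => (⟨f w', σ w'⟩ : TangentBundle I M)) w)
    (hX : MDiffAt (T% X) w) (hY : MDiffAt (T% Y) w) :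
    pullbackConnection J D f (fun w' => pullbackConnection J D f σ w' (Y w')) w (X w)
      - pullbackConnection J D f (fun w' => pullbackConnection J D f σ w' (X w')) w (Y w)
      - pullbackConnection J D f σ w (mlieBracket J X Y w) =
    curvature D (f w) (mfderiv J I f w (X w)) (mfderiv J I f w (Y w)) (σ w) := by
  refine coord_injective (mem_chart_source H (f w)) ?_
  rw [coord_pullbackConnection_commutator hD hf hσ hX hY, coord_curvature hD]

variable [I.Boundaryless]

theorem curvature_antisymm (hD : D.ContMDiffCovariantDerivative ∞)
    (x : M) (a b c : TangentSpace I x) : curvature D x a b c = -curvature D x b a c := by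
  refine coord_injective (mem_chart_source H x) ?_
  rw [map_neg, coord_curvature hD, coord_curvature hD, curvatureCoord, curvatureCoord]
  abel

theorem curvature_add_right (hD : D.ContMDiffCovariantDerivative ∞)
    (x : M) (a b b' c : TangentSpace I x) :
    curvature D x a (b + b') c = curvature D x a b c + curvature D x a b' c := by
  refine coord_injective (mem_chart_source H x) ?_
  rw [map_add, coord_curvature hD, coord_curvature hD, coord_curvature hD, curvatureCoord,
    curvatureCoord, curvatureCoord]
  simp only [ContinuousLinearMap.map_add, add_apply]
  abel

theorem curvature_smul_right (hD : D.ContMDiffCovariantDerivative ∞)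
    (x : M) (r : ℝ) (a b c : TangentSpace I x) :
    curvature D x a (r • b) c = r • curvature D x a b c := by
  refine coord_injective (mem_chart_source H x) ?_
  rw [map_smul, coord_curvature hD, coord_curvature hD, curvatureCoord, curvatureCoord]
  simp only [ContinuousLinearMap.map_smul, smul_apply]
  module

end Curvature

end TangentConn

/-! ### Pull-back connections on the tangent bundle -/

namespace TangentConn

variable {E : Type*} [NormedAddCommGroup E] [NormedSpace ℝ E] [FiniteDimensional ℝ E]
  {H : Type*} [TopologicalSpace H] {I : ModelWithCorners ℝ E H}
  {M : Type*} [TopologicalSpace M] [ChartedSpace H M] [IsManifold I ∞ M]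
  {g : ContMDiffRiemannianMetric I ∞ E (TangentSpace I : M → Type _)}
  {D : CovariantDerivative I E (TangentSpace I : M → Type _)}

/-! ### Sum, Leibniz and metric rules for pull-back connections -/

section PullbackRules

variable {E' : Type*} [NormedAddCommGroup E'] [NormedSpace ℝ E']
  {H' : Type*} [TopologicalSpace H'] {J : ModelWithCorners ℝ E' H'}
  {N : Type*} [TopologicalSpace N] [ChartedSpace H' N]
  {f : N → M} {σ τ : Π w, TangentSpace I (f w)} {w : N}

theorem mdifferentiableAt_along_add (hf : MDifferentiableAt J I f w)
    (hσ : MDifferentiableAt J I.tangent (fun w' => (⟨f w', σ w'⟩ : TangentBundle I M)) w)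
    (hτ : MDifferentiableAt J I.tangent (fun w' => (⟨f w', τ w'⟩ : TangentBundle I M)) w) :
    MDifferentiableAt J I.tangent (fun w' => (⟨f w', σ w' + τ w'⟩ : TangentBundle I M)) w := by
  have hw := mem_chart_source H (f w)
  rw [mdifferentiableAt_along_iff hf hw] at hσ hτ ⊢
  simp only [map_add]
  exact hσ.add hτ

theorem mdifferentiableAt_along_smul {r : N → ℝ} (hf : MDifferentiableAt J I f w)
    (hr : MDifferentiableAt J 𝓘(ℝ, ℝ) r w)
    (hσ : MDifferentiableAt J I.tangent (fun w' => (⟨f w', σ w'⟩ : TangentBundle I M)) w) :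
    MDifferentiableAt J I.tangent (fun w' => (⟨f w', r w' • σ w'⟩ : TangentBundle I M)) w := by
  have hw := mem_chart_source H (f w)
  rw [mdifferentiableAt_along_iff hf hw] at hσ ⊢
  simp only [map_smul]
  exact hr.smul hσ

theorem pullbackConnection_add (hf : MDifferentiableAt J I f w)
    (hσ : MDifferentiableAt J I.tangent (fun w' => (⟨f w', σ w'⟩ : TangentBundle I M)) w)
    (hτ : MDifferentiableAt J I.tangent (fun w' => (⟨f w', τ w'⟩ : TangentBundle I M)) w) :
    pullbackConnection J D f (fun w' => σ w' + τ w') w =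
      pullbackConnection J D f σ w + pullbackConnection J D f τ w := by
  have hw := mem_chart_source H (f w)
  ext v
  refine coord_injective hw ?_
  rw [coord_pullbackConnection hf (mdifferentiableAt_along_add hf hσ hτ) hw, add_apply,
    (coord (f w) (f w)).map_add (pullbackConnection J D f σ w v),
    coord_pullbackConnection hf hσ hw, coord_pullbackConnection hf hτ hw]
  simp only [map_add, add_apply]
  rw [mvfderiv_fun_add ((mdifferentiableAt_along_iff hf hw).1 hσ)
    ((mdifferentiableAt_along_iff hf hw).1 hτ), add_apply]
  abel

theorem pullbackConnection_smul {r : N → ℝ} (hf : MDifferentiableAt J I f w)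
    (hr : MDifferentiableAt J 𝓘(ℝ, ℝ) r w)
    (hσ : MDifferentiableAt J I.tangent (fun w' => (⟨f w', σ w'⟩ : TangentBundle I M)) w)
    (v : TangentSpace J w) :
    pullbackConnection J D f (fun w' => r w' • σ w') w v =
      r w • pullbackConnection J D f σ w v + mvfderiv J r w v • σ w := by
  have hw := mem_chart_source H (f w)
  refine coord_injective hw ?_
  rw [coord_pullbackConnection hf (mdifferentiableAt_along_smul hf hr hσ) hw,
    (coord (f w) (f w)).map_add,
    (coord (f w) (f w)).map_smul (r w) (pullbackConnection J D f σ w v), coord_pullbackConnection hf hσ hw]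
  simp only [map_smul, smul_apply]
  rw [mvfderiv_fun_smul hr ((mdifferentiableAt_along_iff hf hw).1 hσ)]
  simp
  abel

/-- The pull-back of a metric connection is metric for the pull-back metric. -/
theorem IsMetricConnection.pullbackConnection (hgD : IsMetricConnection g D)
    (hf : MDifferentiableAt J I f w)
    (hσ : MDifferentiableAt J I.tangent (fun w' => (⟨f w', σ w'⟩ : TangentBundle I M)) w)
    (hτ : MDifferentiableAt J I.tangent (fun w' => (⟨f w', τ w'⟩ : TangentBundle I M)) w)
    (v : TangentSpace J w) :
    mvfderiv J (fun w' => g.inner (f w') (σ w') (τ w')) w v =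
      g.inner (f w) (TangentConn.pullbackConnection J D f σ w v) (τ w)
        + g.inner (f w) (σ w) (TangentConn.pullbackConnection J D f τ w v) := by
  have hw := mem_chart_source H (f w)
  obtain ⟨G, hGs, hG⟩ := exists_coord_metric g (f w)
  have hGd := hGs.mdifferentiableAt (by simp)
  have hGf : MDifferentiableAt J 𝓘(ℝ, E →L[ℝ] E →L[ℝ] ℝ) (fun w' => G (f w')) w :=
    hGd.comp w hf
  have hs := (mdifferentiableAt_along_iff hf hw).1 hσ
  have ht := (mdifferentiableAt_along_iff hf hw).1 hτ
  have h1 : (fun w' => g.inner (f w') (σ w') (τ w')) =ᶠ[𝓝 w]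
      fun w' => G (f w') (coord (f w) (f w') (σ w')) (coord (f w) (f w') (τ w')) := by
    filter_upwards [hf.continuousAt.eventually ((chartAt H (f w)).open_source.mem_nhds hw)]
      with w' hw'
    rw [hG _ hw', coordField_coord hw', coordField_coord hw']
  have hcF : ∀ (σ : Π w, TangentSpace I (f w)),
      MDifferentiableAt J I.tangent (fun w' => (⟨f w', σ w'⟩ : TangentBundle I M)) w →
      TangentConn.pullbackConnection J D f σ w v =
      coordField (f w) (mvfderiv J (fun w' => coord (f w) (f w') (σ w')) w v) (f w)
        + D (coordField (f w) (coord (f w) (f w) (σ w))) (f w) (mfderiv J I f w v) := by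
    intro σ hσ
    refine coord_injective hw ?_
    rw [coord_pullbackConnection hf hσ hw, map_add, coord_coordField hw, christoffel_apply hw,
      coordField_coord hw]
  -- On fields with constant components, metricity computes the derivative of the metric
  -- coefficients `G`. The general case then follows from the product rule along `f`.
  have hmet := hgD (f w) _ _ (mdifferentiableAt_coordField hw (coord (f w) (f w) (σ w)))
    (mdifferentiableAt_coordField hw (coord (f w) (f w) (τ w))) (mfderiv J I f w v)
  have h2 : (fun y => g.inner y (coordField (f w) (coord (f w) (f w) (σ w)) y)
      (coordField (f w) (coord (f w) (f w) (τ w)) y)) =ᶠ[𝓝 (f w)]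
      fun y => G y (coord (f w) (f w) (σ w)) (coord (f w) (f w) (τ w)) := by
    filter_upwards [(chartAt H (f w)).open_source.mem_nhds hw] with y hy
    rw [hG _ hy]
  rw [h2.mvfderiv_eq, mvfderiv_clm_apply (b := fun _ => coord (f w) (f w) (τ w))
    (hGd.clm_apply mdifferentiableAt_const) mdifferentiableAt_const, mvfderiv_clm_apply
    (b := fun _ => coord (f w) (f w) (σ w)) hGd mdifferentiableAt_const, mvfderiv_const,
    mvfderiv_const] at hmet
  simp only [zero_apply, map_zero, add_zero, coordField_coord hw] at hmet
  rw [h1.mvfderiv_eq, mvfderiv_clm_apply (hGf.clm_apply hs) ht, mvfderiv_clm_apply hGf hs,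
    mvfderiv_comp_vector hGd hf, add_apply, hmet, hG _ hw, hG _ hw, hcF σ hσ, hcF τ hτ,
    coordField_coord hw, coordField_coord hw]
  simp only [map_add, add_apply]
  ring

end PullbackRules

/-! ### The projection of the tangent bundle and its canonical section -/

section TangentBundle

variable {X Y Z : Π w : TangentBundle I M, TangentSpace I.tangent w} {u : TangentBundle I M}

theorem contMDiffAt_proj_tangent {n : ℕ∞ω} :
    ContMDiffAt I.tangent I n (fun w : TangentBundle I M => w.proj) u :=
  Bundle.contMDiffAt_proj (TangentSpace I : M → Type _)

theorem contMDiffAt_canonicalSection {n : ℕ∞ω} : ContMDiffAt I.tangent I.tangent n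
    (fun w : TangentBundle I M => (⟨w.proj, w.snd⟩ : TangentBundle I M)) u :=
  contMDiffAt_id

theorem eq_of_dproj_of_vert {V W : TangentSpace I.tangent u} (h1 : dproj u V = dproj u W)
    (h2 : vert D u V = vert D u W) : V = W :=
  (isInvertible_splitting D u).injective (Prod.ext h1 h2)

theorem hLift_dproj_add_vLift_vert (D : CovariantDerivative I E (TangentSpace I : M → Type _))
    (V : TangentSpace I.tangent u) : hLift D u (dproj u V) + vLift u (vert D u V) = V := by
  refine eq_of_dproj_of_vert (D := D) ?_ ?_
  · rw [map_add, dproj_hLift, dproj_vLift, add_zero]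
  · rw [map_add, vert_hLift, vert_vLift, zero_add]

theorem mdifferentiableAt_dproj (hY : MDiffAt (T% Y) u) : MDifferentiableAt I.tangent I.tangent
    (fun w => (⟨w.proj, dproj w (Y w)⟩ : TangentBundle I M)) u :=
  mdifferentiableAt_mfderiv_apply contMDiffAt_proj_tangent hY

theorem mdifferentiableAt_vert [T2Space M] (hD : D.ContMDiffCovariantDerivative ∞)
    (hY : MDiffAt (T% Y) u) : MDifferentiableAt I.tangent I.tangent
    (fun w => (⟨w.proj, vert D w (Y w)⟩ : TangentBundle I M)) u :=
  mdifferentiableAt_pullbackConnection hD contMDiffAt_proj_tangent contMDiffAt_canonicalSection hY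

theorem contMDiffAt_dproj (hY : CMDiffAt ∞ (T% Y) u) : ContMDiffAt I.tangent I.tangent ∞
    (fun w => (⟨w.proj, dproj w (Y w)⟩ : TangentBundle I M)) u :=
  contMDiffAt_mfderiv_apply contMDiffAt_proj_tangent hY

theorem contMDiffAt_vert [T2Space M] (hD : D.ContMDiffCovariantDerivative ∞)
    (hY : CMDiffAt ∞ (T% Y) u) : ContMDiffAt I.tangent I.tangent ∞
    (fun w => (⟨w.proj, vert D w (Y w)⟩ : TangentBundle I M)) u :=
  contMDiffAt_pullbackConnection hD contMDiffAt_proj_tangent contMDiffAt_canonicalSection hY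

variable [I.Boundaryless]

/-- The torsion structure equation along π. -/
theorem pullback_dproj_sub (hX : MDiffAt (T% X) u) (hY : MDiffAt (T% Y) u) :
    pullback D (fun w => dproj w (Y w)) u (X u) - pullback D (fun w => dproj w (X w)) u (Y u)
      - dproj u (mlieBracket I.tangent X Y u) =
    D.torsion u.proj (dproj u (X u)) (dproj u (Y u)) :=
  pullbackConnection_torsion contMDiffAt_proj_tangent hX hY

/-- The curvature structure equation along π for the section ξ, since `vert` is ∇^*ξ. This is where
the term R^*ξ of the formula originates. -/
theorem pullback_vert_sub [T2Space M] (hD : D.ContMDiffCovariantDerivative ∞)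
    (hX : MDiffAt (T% X) u) (hY : MDiffAt (T% Y) u) :
    pullback D (fun w => vert D w (Y w)) u (X u) - pullback D (fun w => vert D w (X w)) u (Y u)
      - vert D u (mlieBracket I.tangent X Y u) = curvXi D u (X u) (Y u) :=
  pullbackConnection_curvature hD contMDiffAt_proj_tangent contMDiffAt_canonicalSection hX hY

end TangentBundle

end TangentConn

/-! ### The weighted metric -/

namespace TangentConn

variable {E : Type*} [NormedAddCommGroup E] [NormedSpace ℝ E] [FiniteDimensional ℝ E]
  {H : Type*} [TopologicalSpace H] {I : ModelWithCorners ℝ E H}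
  {M : Type*} [TopologicalSpace M] [ChartedSpace H M] [IsManifold I ∞ M]
  {g : ContMDiffRiemannianMetric I ∞ E (TangentSpace I : M → Type _)}
  {D : CovariantDerivative I E (TangentSpace I : M → Type _)} {φ₁ φ₂ : M → ℝ}

/-- The bilinear form `g (A v, A w)`. -/
def pullbackInner (g : ContMDiffRiemannianMetric I ∞ E (TangentSpace I : M → Type _))
    (u : TangentBundle I M) (A : TangentSpace I.tangent u →L[ℝ] TangentSpace I u.proj) :
    TangentSpace I.tangent u →L[ℝ] TangentSpace I.tangent u →L[ℝ] ℝ :=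
  (ContinuousLinearMap.precomp ℝ A).comp ((g.inner u.proj).comp A)

/-- The bilinear form `weightedMetric` as a continuous bilinear map. -/
def weightedInner (g : ContMDiffRiemannianMetric I ∞ E (TangentSpace I : M → Type _))
    (D : CovariantDerivative I E (TangentSpace I : M → Type _)) (φ₁ φ₂ : M → ℝ)
    (u : TangentBundle I M) :
    TangentSpace I.tangent u →L[ℝ] TangentSpace I.tangent u →L[ℝ] ℝ :=
  Real.exp (2 * φ₁ u.proj) • pullbackInner g u (dproj u)
    + Real.exp (2 * φ₂ u.proj) • pullbackInner g u (vert D u)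

theorem weightedInner_apply (u : TangentBundle I M) (v w : TangentSpace I.tangent u) :
    weightedInner g D φ₁ φ₂ u v w = weightedMetric g D φ₁ φ₂ u v w := rfl

theorem inner_self_nonneg (x : M) (v : TangentSpace I x) : 0 ≤ g.inner x v v := by
  rcases eq_or_ne v 0 with rfl | h
  · rw [map_zero]
  · exact (g.pos x v h).le

theorem weightedInner_pos (u : TangentBundle I M) (v : TangentSpace I.tangent u) (hv : v ≠ 0) :
    0 < weightedInner g D φ₁ φ₂ u v v := by
  rw [weightedInner_apply, weightedMetric]
  by_cases h : dproj u v = 0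
  · have h' : vert D u v ≠ 0 := fun h' => hv <| eq_of_dproj_of_vert (D := D)
      (h.trans (map_zero _).symm) (h'.trans (map_zero _).symm)
    exact add_pos_of_nonneg_of_pos (mul_nonneg (Real.exp_pos _).le (inner_self_nonneg _ _))
      (mul_pos (Real.exp_pos _) (g.pos _ _ h'))
  · exact add_pos_of_pos_of_nonneg (mul_pos (Real.exp_pos _) (g.pos _ _ h))
      (mul_nonneg (Real.exp_pos _).le (inner_self_nonneg _ _))

theorem isVonNBounded_setOf_mul_inner_lt (x : M) (r : ℝ) :
    Bornology.IsVonNBounded ℝ {v : TangentSpace I x | Real.exp (2 * r) * g.inner x v v < 1} := by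
  refine ((g.isVonNBounded x).image (Real.exp (-r) • ContinuousLinearMap.id ℝ _)).subset ?_
  intro v hv
  -- The set is the unit ball of `g` scaled by e^{-r}, because e^{2r} = (e^r)^2.
  refine ⟨Real.exp r • v, ?_, ?_⟩
  · have h : Real.exp (2 * r) = Real.exp r * Real.exp r := by rw [← Real.exp_add]; ring_nf
    simp only [Set.mem_ofPred_eq, h] at hv ⊢
    rw [(g.inner x).map_smul, smul_apply, (g.inner x v).map_smul, smul_smul]
    exact hv
  · simp [smul_smul, ← Real.exp_add]

/-- Both summands of G(v, v) are nonnegative, so each is below 1. The ball therefore lies in the sum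
of the lifts of two bounded sets. -/
theorem isVonNBounded_weightedInner (u : TangentBundle I M) :
    Bornology.IsVonNBounded ℝ {v | weightedInner g D φ₁ φ₂ u v v < 1} := by
  refine (((isVonNBounded_setOf_mul_inner_lt (g := g) u.proj (φ₁ u.proj)).image (hLift D u)).add
    ((isVonNBounded_setOf_mul_inner_lt (g := g) u.proj (φ₂ u.proj)).image (vLift u))).subset ?_
  intro v hv
  rw [Set.mem_ofPred_eq, weightedInner_apply, weightedMetric] at hv
  have h1 := mul_nonneg (Real.exp_pos (2 * φ₁ u.proj)).le
    (inner_self_nonneg (g := g) u.proj (dproj u v))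
  have h2 := mul_nonneg (Real.exp_pos (2 * φ₂ u.proj)).le
    (inner_self_nonneg (g := g) u.proj (vert D u v))
  exact ⟨_, ⟨dproj u v, by simp only [Set.mem_ofPred_eq]; linarith, rfl⟩, _,
    ⟨vert D u v, by simp only [Set.mem_ofPred_eq]; linarith, rfl⟩, hLift_dproj_add_vLift_vert D v⟩

theorem contMDiff_exp_comp_proj {φ : M → ℝ} (hφ : ContMDiff I 𝓘(ℝ, ℝ) ∞ φ) :
    ContMDiff I.tangent 𝓘(ℝ, ℝ) ∞ fun u : TangentBundle I M => Real.exp (2 * φ u.proj) := by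
  have h : ContMDiff 𝓘(ℝ, ℝ) 𝓘(ℝ, ℝ) ∞ fun t : ℝ => Real.exp (2 * t) :=
    (Real.contDiff_exp.comp (contDiff_const.mul contDiff_id)).contMDiff
  exact h.comp (hφ.comp fun u => contMDiffAt_proj_tangent)

/-- The metric `f₁ π^*g ⊕ f₂ π^*g` on the manifold `TM`. -/
def weightedRiemannianMetric [T2Space M]
    (g : ContMDiffRiemannianMetric I ∞ E (TangentSpace I : M → Type _))
    (hD : D.ContMDiffCovariantDerivative ∞)
    (hφ₁ : ContMDiff I 𝓘(ℝ, ℝ) ∞ φ₁) (hφ₂ : ContMDiff I 𝓘(ℝ, ℝ) ∞ φ₂) :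
    ContMDiffRiemannianMetric I.tangent ∞ (E × E)
      (TangentSpace I.tangent : TangentBundle I M → Type _) where
  inner := weightedInner g D φ₁ φ₂
  symm u v w := by
    simp only [weightedInner_apply, weightedMetric]
    rw [g.symm u.proj (dproj u v), g.symm u.proj (vert D u v)]
  pos := weightedInner_pos
  isVonNBounded := isVonNBounded_weightedInner
  contMDiff u := by
    refine contMDiffAt_bilin_of_coord fun a c => ?_
    have hc : ∀ a, ContMDiffAt I.tangent I.tangent.tangent ∞ (T% (coordField u a)) u :=
      contMDiffAt_coordField (mem_chart_source _ u)
    exact ((contMDiff_exp_comp_proj hφ₁ u).mul (contMDiffAt_metric_apply g contMDiffAt_proj_tangent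
        (contMDiffAt_dproj (hc a)) (contMDiffAt_dproj (hc c)))).add
      ((contMDiff_exp_comp_proj hφ₂ u).mul (contMDiffAt_metric_apply g contMDiffAt_proj_tangent
        (contMDiffAt_vert hD (hc a)) (contMDiffAt_vert hD (hc c))))

end TangentConn

/-! ### The formula for the Levi-Civita connection -/

namespace TangentConn

variable {E : Type*} [NormedAddCommGroup E] [NormedSpace ℝ E] [FiniteDimensional ℝ E]
  {H : Type*} [TopologicalSpace H] {I : ModelWithCorners ℝ E H}
  {M : Type*} [TopologicalSpace M] [ChartedSpace H M] [IsManifold I ∞ M]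
  {g : ContMDiffRiemannianMetric I ∞ E (TangentSpace I : M → Type _)}
  {D : CovariantDerivative I E (TangentSpace I : M → Type _)} {φ₁ φ₂ : M → ℝ}

/-- `sharp` accepts bare functions, so linearity must be supplied before its defining property can
be used. -/
theorem inner_sharp_of_isLinearMap {x : M} {ℓ : TangentSpace I x → ℝ} (hℓ : IsLinearMap ℝ ℓ)
    (z : TangentSpace I x) : g.inner x (sharp g x ℓ) z = ℓ z :=
  inner_sharp g x (hℓ.mk' ℓ) z

theorem inner_grad (φ : M → ℝ) (x : M) (z : TangentSpace I x) :
    g.inner x (grad g φ x) z = mvfderiv I φ x z :=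
  inner_sharp_of_isLinearMap ⟨map_add _, map_smul _⟩ z

theorem inner_add_left {x : M} (a b z : TangentSpace I x) :
    g.inner x (a + b) z = g.inner x a z + g.inner x b z := by
  rw [(g.inner x).map_add]; rfl

theorem inner_sub_left {x : M} (a b z : TangentSpace I x) :
    g.inner x (a - b) z = g.inner x a z - g.inner x b z := by
  rw [(g.inner x).map_sub]; rfl

theorem inner_neg_left {x : M} (a z : TangentSpace I x) :
    g.inner x (-a) z = -g.inner x a z := by
  rw [(g.inner x).map_neg]; rfl

theorem inner_smul_left {x : M} (r : ℝ) (a z : TangentSpace I x) :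
    g.inner x (r • a) z = r * g.inner x a z := by
  rw [(g.inner x).map_smul]; rfl

variable [T2Space M] [I.Boundaryless]

theorem curvature_add_left (hD : D.ContMDiffCovariantDerivative ∞) (x : M)
    (a b z c : TangentSpace I x) :
    curvature D x (a + b) z c = curvature D x a z c + curvature D x b z c := by
  rw [curvature_antisymm hD, curvature_add_right hD, curvature_antisymm hD x z,
    curvature_antisymm hD x z]
  abel

theorem curvature_smul_left (hD : D.ContMDiffCovariantDerivative ∞) (x : M)
    (r : ℝ) (a z c : TangentSpace I x) :
    curvature D x (r • a) z c = r • curvature D x a z c := by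
  rw [curvature_antisymm hD, curvature_smul_right hD, curvature_antisymm hD x z, smul_neg, neg_neg]

/-- The right-hand side of the formula for the Levi-Civita connection of the weighted metric. -/
def leviCivitaFormula (g : ContMDiffRiemannianMetric I ∞ E (TangentSpace I : M → Type _))
    (D : CovariantDerivative I E (TangentSpace I : M → Type _)) (φ₁ φ₂ : M → ℝ)
    (u : TangentBundle I M) (X : TangentSpace I.tangent u)
    (Y : Π w : TangentBundle I M, TangentSpace I.tangent w) : TangentSpace I.tangent u :=
  Dstar g D φ₁ φ₂ u X Y - (1 / 2 : ℝ) • Rcal D u X (Y u) + tensorA g D φ₁ φ₂ u X (Y u)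
    + tensorB g D φ₁ φ₂ u X (Y u) + tensorTau g D u X (Y u)

variable {u : TangentBundle I M} {V : TangentSpace I.tangent u}
  {X Y Z : Π w : TangentBundle I M, TangentSpace I.tangent w}

/-- A, τ and the gradient terms are horizontal and drop out. Together with the next lemma, this lets
every later identity be checked componentwise, without lifts or `sharp`. -/
theorem vert_leviCivitaFormula : vert D u (leviCivitaFormula g D φ₁ φ₂ u V Y) =
    pullback D (fun w => vert D w (Y w)) u V
      + mvfderiv I φ₂ u.proj (dproj u V) • vert D u (Y u)
      - (1 / 2 : ℝ) • curvXi D u V (Y u)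
      + mvfderiv I φ₂ u.proj (dproj u (Y u)) • vert D u V := by
  simp only [leviCivitaFormula, Dstar, Rcal, tensorA, tensorB, tensorTau,
    ContinuousLinearMap.map_add, ContinuousLinearMap.map_sub, ContinuousLinearMap.map_smul,
    vert_hLift, vert_vLift, smul_zero, zero_add, add_zero, sub_zero]

theorem inner_dproj_leviCivitaFormula (hD : D.ContMDiffCovariantDerivative ∞)
    (z : TangentSpace I u.proj) :
    g.inner u.proj (dproj u (leviCivitaFormula g D φ₁ φ₂ u V Y)) z =
      g.inner u.proj (pullback D (fun w => dproj w (Y w)) u V) z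
      + (mvfderiv I φ₁ u.proj (dproj u V) * g.inner u.proj (dproj u (Y u)) z
        + mvfderiv I φ₁ u.proj (dproj u (Y u)) * g.inner u.proj (dproj u V) z
        - g.inner u.proj (dproj u V) (dproj u (Y u)) * mvfderiv I φ₁ u.proj z)
      + (Real.exp (2 * φ₁ u.proj))⁻¹ * (Real.exp (2 * φ₂ u.proj) / 2 *
        (g.inner u.proj (curvature D u.proj (dproj u V) z u.snd) (vert D u (Y u))
          + g.inner u.proj (curvature D u.proj (dproj u (Y u)) z u.snd) (vert D u V)))
      - Real.exp (2 * φ₂ u.proj) / Real.exp (2 * φ₁ u.proj)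
        * g.inner u.proj (vert D u V) (vert D u (Y u)) * mvfderiv I φ₂ u.proj z
      + (torsionForm g D u.proj (dproj u (Y u)) (dproj u V) z
        + torsionForm g D u.proj (dproj u V) z (dproj u (Y u))
        + torsionForm g D u.proj (dproj u (Y u)) z (dproj u V)) / 2 := by
  simp only [leviCivitaFormula, Dstar, Rcal, tensorA, tensorB, tensorTau, confTensor,
    ContinuousLinearMap.map_add, ContinuousLinearMap.map_sub, ContinuousLinearMap.map_smul,
    dproj_hLift, dproj_vLift, smul_zero, add_zero, sub_zero, zero_sub,
    ContinuousLinearMap.map_neg, add_apply, sub_apply, smul_apply, neg_apply, inner_grad,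
    smul_eq_mul]
  -- The forms defining A and τ must be linear in `z`; for A this rests on the tensoriality of the
  -- curvature.
  rw [inner_sharp_of_isLinearMap, inner_sharp_of_isLinearMap]
  · ring
  · constructor
    · intro a b
      simp only [torsionForm, ContinuousLinearMap.map_add, add_apply]
      ring
    · intro r a
      simp only [torsionForm, ContinuousLinearMap.map_smul, smul_apply, smul_eq_mul]
      ring
  · constructor
    · intro a b
      simp only [curvature_add_right hD, inner_add_left]
      ring
    · intro r a
      simp only [curvature_smul_right hD, inner_smul_left, smul_eq_mul]
      ring

theorem eq_of_inner_dproj_of_vert (g : ContMDiffRiemannianMetric I ∞ E (TangentSpace I : M → Type _))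
    {V W : TangentSpace I.tangent u}
    (h1 : ∀ z, g.inner u.proj (dproj u V) z = g.inner u.proj (dproj u W) z)
    (h2 : vert D u V = vert D u W) : V = W :=
  eq_of_dproj_of_vert (eq_of_forall_inner_eq g h1) h2

theorem leviCivitaFormula_add_left (hD : D.ContMDiffCovariantDerivative ∞)
    (V W : TangentSpace I.tangent u) :
    leviCivitaFormula g D φ₁ φ₂ u (V + W) Y =
      leviCivitaFormula g D φ₁ φ₂ u V Y + leviCivitaFormula g D φ₁ φ₂ u W Y := by
  refine eq_of_inner_dproj_of_vert (D := D) g (fun z => ?_) ?_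
  · rw [(dproj u).map_add (leviCivitaFormula g D φ₁ φ₂ u V Y), inner_add_left]
    simp only [inner_dproj_leviCivitaFormula hD, ContinuousLinearMap.map_add, torsionForm,
      add_apply, curvature_add_left hD]
    ring
  · rw [(vert D u).map_add (leviCivitaFormula g D φ₁ φ₂ u V Y)]
    simp only [vert_leviCivitaFormula, curvXi, ContinuousLinearMap.map_add, curvature_add_left hD]
    module

theorem leviCivitaFormula_smul_left (hD : D.ContMDiffCovariantDerivative ∞)
    (r : ℝ) (V : TangentSpace I.tangent u) :
    leviCivitaFormula g D φ₁ φ₂ u (r • V) Y = r • leviCivitaFormula g D φ₁ φ₂ u V Y := by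
  refine eq_of_inner_dproj_of_vert (D := D) g (fun z => ?_) ?_
  · rw [(dproj u).map_smul r (leviCivitaFormula g D φ₁ φ₂ u V Y), inner_smul_left]
    simp only [inner_dproj_leviCivitaFormula hD, ContinuousLinearMap.map_smul, torsionForm,
      smul_apply, curvature_smul_left hD, smul_eq_mul]
    ring
  · rw [(vert D u).map_smul r (leviCivitaFormula g D φ₁ φ₂ u V Y)]
    simp only [vert_leviCivitaFormula, curvXi, ContinuousLinearMap.map_smul,
      curvature_smul_left hD, smul_eq_mul]
    module

theorem pullback_dproj_add (hY : MDiffAt (T% Y) u) (hZ : MDiffAt (T% Z) u) :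
    pullback D (fun w => dproj w (Y w) + dproj w (Z w)) u V =
      pullback D (fun w => dproj w (Y w)) u V + pullback D (fun w => dproj w (Z w)) u V :=
  DFunLike.congr_fun (pullbackConnection_add (contMDiffAt_proj_tangent (n := 1).mdifferentiableAt
    one_ne_zero) (mdifferentiableAt_dproj hY) (mdifferentiableAt_dproj hZ)) V

theorem pullback_vert_add (hD : D.ContMDiffCovariantDerivative ∞)
    (hY : MDiffAt (T% Y) u) (hZ : MDiffAt (T% Z) u) :
    pullback D (fun w => vert D w (Y w) + vert D w (Z w)) u V =
      pullback D (fun w => vert D w (Y w)) u V + pullback D (fun w => vert D w (Z w)) u V :=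
  DFunLike.congr_fun (pullbackConnection_add (contMDiffAt_proj_tangent (n := 1).mdifferentiableAt
    one_ne_zero) (mdifferentiableAt_vert hD hY) (mdifferentiableAt_vert hD hZ)) V

theorem pullback_dproj_smul {r : TangentBundle I M → ℝ} (hr : MDiffAt r u)
    (hY : MDiffAt (T% Y) u) :
    pullback D (fun w => r w • dproj w (Y w)) u V =
      r u • pullback D (fun w => dproj w (Y w)) u V
        + mvfderiv I.tangent r u V • dproj u (Y u) :=
  pullbackConnection_smul (contMDiffAt_proj_tangent (n := 1).mdifferentiableAt
    one_ne_zero) hr (mdifferentiableAt_dproj hY) V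

theorem pullback_vert_smul {r : TangentBundle I M → ℝ} (hD : D.ContMDiffCovariantDerivative ∞)
    (hr : MDiffAt r u) (hY : MDiffAt (T% Y) u) :
    pullback D (fun w => r w • vert D w (Y w)) u V =
      r u • pullback D (fun w => vert D w (Y w)) u V
        + mvfderiv I.tangent r u V • vert D u (Y u) :=
  pullbackConnection_smul (contMDiffAt_proj_tangent (n := 1).mdifferentiableAt
    one_ne_zero) hr (mdifferentiableAt_vert hD hY) V

theorem leviCivitaFormula_add_right (hD : D.ContMDiffCovariantDerivative ∞)
    (hY : MDiffAt (T% Y) u) (hZ : MDiffAt (T% Z) u) :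
    leviCivitaFormula g D φ₁ φ₂ u V (Y + Z) =
      leviCivitaFormula g D φ₁ φ₂ u V Y + leviCivitaFormula g D φ₁ φ₂ u V Z := by
  refine eq_of_inner_dproj_of_vert (D := D) g (fun z => ?_) ?_
  · rw [(dproj u).map_add (leviCivitaFormula g D φ₁ φ₂ u V Y), inner_add_left]
    simp only [inner_dproj_leviCivitaFormula hD, pullback_dproj_add hY hZ, Pi.add_apply,
      ContinuousLinearMap.map_add, torsionForm,
      add_apply, curvature_add_left hD]
    ring
  · rw [(vert D u).map_add (leviCivitaFormula g D φ₁ φ₂ u V Y)]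
    simp only [vert_leviCivitaFormula, pullback_vert_add hD hY hZ, Pi.add_apply, curvXi,
      ContinuousLinearMap.map_add, curvature_add_right hD]
    module

/-- Only the two ∇^* terms differentiate `Y`; they contribute the derivative of `r` times both
components of `Y u`. All other terms are tensorial in `Y`. -/
theorem leviCivitaFormula_smul_right {r : TangentBundle I M → ℝ}
    (hD : D.ContMDiffCovariantDerivative ∞) (hr : MDiffAt r u) (hY : MDiffAt (T% Y) u) :
    leviCivitaFormula g D φ₁ φ₂ u V (r • Y) =
      r u • leviCivitaFormula g D φ₁ φ₂ u V Y + mvfderiv I.tangent r u V • Y u := by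
  refine eq_of_inner_dproj_of_vert (D := D) g (fun z => ?_) ?_
  · rw [(dproj u).map_add, (dproj u).map_smul (r u) (leviCivitaFormula g D φ₁ φ₂ u V Y),
      (dproj u).map_smul _ (Y u), inner_add_left, inner_smul_left, inner_smul_left]
    simp only [inner_dproj_leviCivitaFormula hD, pullback_dproj_smul hr hY, Pi.smul_apply',
      ContinuousLinearMap.map_smul, ContinuousLinearMap.map_add, torsionForm, add_apply,
      curvature_smul_left hD, smul_apply, smul_eq_mul]
    ring
  · rw [(vert D u).map_add, (vert D u).map_smul (r u) (leviCivitaFormula g D φ₁ φ₂ u V Y),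
      (vert D u).map_smul _ (Y u)]
    simp only [vert_leviCivitaFormula, pullback_vert_smul hD hr hY, Pi.smul_apply', curvXi,
      ContinuousLinearMap.map_smul, curvature_smul_right hD, smul_eq_mul]
    module

end TangentConn

/-! ### The Levi-Civita connection of the weighted metric -/

namespace TangentConn

variable {E : Type*} [NormedAddCommGroup E] [NormedSpace ℝ E] [FiniteDimensional ℝ E]
  {H : Type*} [TopologicalSpace H] {I : ModelWithCorners ℝ E H} [I.Boundaryless]
  {M : Type*} [TopologicalSpace M] [T2Space M] [ChartedSpace H M] [IsManifold I ∞ M]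
  {g : ContMDiffRiemannianMetric I ∞ E (TangentSpace I : M → Type _)}
  {D : CovariantDerivative I E (TangentSpace I : M → Type _)} {φ₁ φ₂ : M → ℝ}

/-- The connection on `TM` given by `leviCivitaFormula`. -/
def weightedConnection (g : ContMDiffRiemannianMetric I ∞ E (TangentSpace I : M → Type _))
    (hD : D.ContMDiffCovariantDerivative ∞) (φ₁ φ₂ : M → ℝ) :
    CovariantDerivative I.tangent (E × E)
      (TangentSpace I.tangent : TangentBundle I M → Type _) where
  toFun Y u :=
    have : FiniteDimensional ℝ (TangentSpace I.tangent u) :=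
      inferInstanceAs (FiniteDimensional ℝ (E × E))
    have : T2Space (TangentSpace I.tangent u) := inferInstanceAs (T2Space (E × E))
    LinearMap.toContinuousLinearMap
      { toFun := fun V => leviCivitaFormula g D φ₁ φ₂ u V Y
        map_add' := leviCivitaFormula_add_left hD
        map_smul' := leviCivitaFormula_smul_left hD }
  isCovariantDerivativeOnUniv :=
    { add := fun hY hZ _ => ContinuousLinearMap.ext fun _ => leviCivitaFormula_add_right hD hY hZ
      leibniz := fun hY hr _ =>
        ContinuousLinearMap.ext fun _ => leviCivitaFormula_smul_right hD hr hY }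

theorem weightedConnection_apply (hD : D.ContMDiffCovariantDerivative ∞) (u : TangentBundle I M)
    (V : TangentSpace I.tangent u) (Y : Π w : TangentBundle I M, TangentSpace I.tangent w) :
    weightedConnection g hD φ₁ φ₂ Y u V = leviCivitaFormula g D φ₁ φ₂ u V Y := rfl

/-- Each component is one structure equation: τ cancels the torsion of ∇ horizontally, -R^*ξ/2
cancels the curvature vertically, and all other corrections are symmetric. -/
theorem weightedConnection_torsion (hD : D.ContMDiffCovariantDerivative ∞) :
    (weightedConnection g hD φ₁ φ₂).torsion = 0 := by
  rw [CovariantDerivative.torsion_eq_zero_iff]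
  intro X Y u hX hY
  rw [weightedConnection_apply, weightedConnection_apply]
  refine eq_of_inner_dproj_of_vert (D := D) g (fun z => ?_) ?_
  · have h1 := congrArg (fun v => g.inner u.proj v z) (pullback_dproj_sub (D := D) hX hY)
    have h2 := congrArg (fun v => g.inner u.proj v z)
      (D.torsion_antisymm (dproj u (X u)) (dproj u (Y u)))
    simp only [inner_sub_left, inner_neg_left] at h1 h2
    rw [(dproj u).map_sub, inner_sub_left, inner_dproj_leviCivitaFormula hD,
      inner_dproj_leviCivitaFormula hD, g.symm u.proj (dproj u (Y u)) (dproj u (X u)),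
      g.symm u.proj (vert D u (Y u)) (vert D u (X u))]
    simp only [torsionForm]
    -- The alternation of τ is half of T(Y,X) - T(X,Y), which `h2` turns into -T(X,Y).
    linear_combination h1 + h2 / 2
  · have h1 := pullback_vert_sub hD hX hY
    have h2 : curvXi D u (Y u) (X u) = -curvXi D u (X u) (Y u) := curvature_antisymm hD ..
    rw [(vert D u).map_sub, vert_leviCivitaFormula, vert_leviCivitaFormula, h2]
    rw [sub_eq_iff_eq_add] at h1
    rw [sub_eq_iff_eq_add] at h1
    rw [h1]
    module

theorem mvfderiv_exp_comp_proj {φ : M → ℝ} (hφ : ContMDiff I 𝓘(ℝ, ℝ) ∞ φ) (u : TangentBundle I M)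
    (V : TangentSpace I.tangent u) :
    mvfderiv I.tangent (fun w : TangentBundle I M => Real.exp (2 * φ w.proj)) u V =
      Real.exp (2 * φ u.proj) * (2 * mvfderiv I φ u.proj (dproj u V)) := by
  have h1 : MDifferentiableAt I 𝓘(ℝ, ℝ) φ u.proj := (hφ u.proj).mdifferentiableAt (by simp)
  have h2 := mvfderiv_comp_vector h1
    ((contMDiffAt_proj_tangent (n := 1) (u := u)).mdifferentiableAt one_ne_zero) V
  have h3 : MDifferentiableAt I.tangent 𝓘(ℝ, ℝ) (fun w : TangentBundle I M => φ w.proj) u :=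
    h1.comp u ((contMDiffAt_proj_tangent (n := 1) (u := u)).mdifferentiableAt one_ne_zero)
  have h4 : HasDerivAt (fun t : ℝ => Real.exp (2 * t)) (Real.exp (2 * φ u.proj) * 2) (φ u.proj) := by
    simpa using ((hasDerivAt_id (φ u.proj)).const_mul 2).exp
  have h5 := mvfderiv_comp_vector (I := 𝓘(ℝ, ℝ)) (h := fun t : ℝ => Real.exp (2 * t))
    (f := fun w : TangentBundle I M => φ w.proj)
    h4.differentiableAt.mdifferentiableAt h3 V
  have h6 : mvfderiv 𝓘(ℝ, ℝ) (fun t : ℝ => Real.exp (2 * t)) (φ u.proj)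
      (mvfderiv I.tangent (fun w : TangentBundle I M => φ w.proj) u V) =
      mvfderiv I.tangent (fun w : TangentBundle I M => φ w.proj) u V *
        (Real.exp (2 * φ u.proj) * 2) := by
    have h7 : mvfderiv 𝓘(ℝ, ℝ) (fun t : ℝ => Real.exp (2 * t)) (φ u.proj) =
      ContinuousLinearMap.toSpanSingleton ℝ (Real.exp (2 * φ u.proj) * 2) :=
      mfderiv_eq_fderiv.trans h4.hasFDerivAt.fderiv
    rw [h7]
    rfl
  refine (h5.trans h6).trans ?_
  rw [h2, dproj]
  ring

/-- D^* already preserves G: C_1 accounts for the derivative of f_1, and X(φ_2)Y^v for that of f_2.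
What remains is that the tensorial corrections are skew for G. -/
theorem weightedConnection_isMetricConnection (hD : D.ContMDiffCovariantDerivative ∞)
    (hgD : IsMetricConnection g D)
    (hφ₁ : ContMDiff I 𝓘(ℝ, ℝ) ∞ φ₁) (hφ₂ : ContMDiff I 𝓘(ℝ, ℝ) ∞ φ₂) :
    IsMetricConnection (weightedRiemannianMetric g hD hφ₁ hφ₂)
      (weightedConnection g hD φ₁ φ₂) := by
  intro u Y Z hY hZ V
  have hπ := (contMDiffAt_proj_tangent (n := 1) (u := u)).mdifferentiableAt one_ne_zero
  have e1 := (contMDiff_exp_comp_proj hφ₁ u).mdifferentiableAt (by simp)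
  have e2 := (contMDiff_exp_comp_proj hφ₂ u).mdifferentiableAt (by simp)
  have d1 := mdifferentiableAt_metric_apply g hπ (mdifferentiableAt_dproj hY) (mdifferentiableAt_dproj hZ)
  have d2 := mdifferentiableAt_metric_apply g hπ (mdifferentiableAt_vert hD hY) (mdifferentiableAt_vert hD hZ)
  have m1 : _ = g.inner u.proj (pullback D (fun w => dproj w (Y w)) u V) (dproj u (Z u))
      + g.inner u.proj (dproj u (Y u)) (pullback D (fun w => dproj w (Z w)) u V) := hgD.pullbackConnection hπ (mdifferentiableAt_dproj hY) (mdifferentiableAt_dproj hZ) V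
  have m2 : _ = g.inner u.proj (pullback D (fun w => vert D w (Y w)) u V) (vert D u (Z u))
      + g.inner u.proj (vert D u (Y u)) (pullback D (fun w => vert D w (Z w)) u V) := hgD.pullbackConnection hπ (mdifferentiableAt_vert hD hY)
    (mdifferentiableAt_vert hD hZ) V
  have hL : mvfderiv I.tangent
      (fun w => (weightedRiemannianMetric g hD hφ₁ hφ₂).inner w (Y w) (Z w)) u V =
      Real.exp (2 * φ₁ u.proj) * mvfderiv I.tangent
        (fun w => g.inner w.proj (dproj w (Y w)) (dproj w (Z w))) u V
      + g.inner u.proj (dproj u (Y u)) (dproj u (Z u)) *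
        (Real.exp (2 * φ₁ u.proj) * (2 * mvfderiv I φ₁ u.proj (dproj u V)))
      + (Real.exp (2 * φ₂ u.proj) * mvfderiv I.tangent
        (fun w => g.inner w.proj (vert D w (Y w)) (vert D w (Z w))) u V
      + g.inner u.proj (vert D u (Y u)) (vert D u (Z u)) *
        (Real.exp (2 * φ₂ u.proj) * (2 * mvfderiv I φ₂ u.proj (dproj u V)))) := by
    rw [← mvfderiv_exp_comp_proj hφ₁, ← mvfderiv_exp_comp_proj hφ₂]
    have h1 := mvfderiv_fun_mul e1 d1
    have h2 := mvfderiv_fun_mul e2 d2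
    have h3 := mvfderiv_fun_add
      (g := fun w => Real.exp (2 * φ₁ w.proj) * g.inner w.proj (dproj w (Y w)) (dproj w (Z w)))
      (g' := fun w => Real.exp (2 * φ₂ w.proj) * g.inner w.proj (vert D w (Y w)) (vert D w (Z w)))
      (e1.mul d1) (e2.mul d2)
    rw [h1, h2] at h3
    exact DFunLike.congr_fun h3 V
  have hR : g.inner u.proj (curvature D u.proj (dproj u (Z u)) (dproj u (Y u)) u.snd) (vert D u V) =
      -g.inner u.proj (curvature D u.proj (dproj u (Y u)) (dproj u (Z u)) u.snd) (vert D u V) := by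
    rw [curvature_antisymm hD, inner_neg_left]
  have hT : ∀ a b c, torsionForm g D u.proj a b c = -torsionForm g D u.proj b a c :=
    fun a b c => by rw [torsionForm, D.torsion_antisymm, inner_neg_left, torsionForm]
  refine hL.trans ?_
  change _ = weightedMetric g D φ₁ φ₂ u (leviCivitaFormula g D φ₁ φ₂ u V Y) (Z u)
    + weightedMetric g D φ₁ φ₂ u (Y u) (leviCivitaFormula g D φ₁ φ₂ u V Z)
  have k1 : Real.exp (2 * φ₁ u.proj) * (Real.exp (2 * φ₁ u.proj))⁻¹ = 1 :=
    mul_inv_cancel₀ (Real.exp_pos _).ne'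
  have s := g.symm u.proj
  rw [s (dproj u (Y u))] at m1
  rw [s (vert D u (Y u))] at m2
  rw [weightedMetric, weightedMetric, s (dproj u (Y u)) (dproj u (leviCivitaFormula ..)),
    s (vert D u (Y u)) (vert D u (leviCivitaFormula ..)),
    vert_leviCivitaFormula, vert_leviCivitaFormula, inner_dproj_leviCivitaFormula hD,
    inner_dproj_leviCivitaFormula hD]
  simp only [inner_add_left, inner_sub_left, inner_smul_left, curvXi]
  rw [s (dproj u (Z u)) (dproj u (Y u)), s (vert D u (Z u)) (vert D u (Y u))]
  set f₁ := Real.exp (2 * φ₁ u.proj)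
  set f₂ := Real.exp (2 * φ₂ u.proj)
  -- `m1` and `m2` are metricity of ∇^* on the two components. `hR` and `hT` make A - R^*ξ/2 and τ
  -- skew, and `k1` cancels the factor 1/f_1 in A and B against the f_1 of G.
  linear_combination f₁ * m1 + f₂ * m2 - f₂ / 2 * hR
    - f₁ / 2 * (hT (dproj u (Y u)) (dproj u V) (dproj u (Z u))
      + hT (dproj u V) (dproj u (Z u)) (dproj u (Y u))
      + hT (dproj u (Y u)) (dproj u (Z u)) (dproj u V))
    - (f₂ / 2 * (g.inner u.proj (curvature D u.proj (dproj u V) (dproj u (Z u)) u.snd)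
          (vert D u (Y u))
        + g.inner u.proj (curvature D u.proj (dproj u (Y u)) (dproj u (Z u)) u.snd) (vert D u V)
        + g.inner u.proj (curvature D u.proj (dproj u V) (dproj u (Y u)) u.snd) (vert D u (Z u))
        + g.inner u.proj (curvature D u.proj (dproj u (Z u)) (dproj u (Y u)) u.snd) (vert D u V))
      - f₂ * g.inner u.proj (vert D u V) (vert D u (Y u)) * mvfderiv I φ₂ u.proj (dproj u (Z u))
      - f₂ * g.inner u.proj (vert D u V) (vert D u (Z u)) * mvfderiv I φ₂ u.proj (dproj u (Y u)))
      * k1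

theorem weightedConnection_isLeviCivita (hD : D.ContMDiffCovariantDerivative ∞)
    (hgD : IsMetricConnection g D)
    (hφ₁ : ContMDiff I 𝓘(ℝ, ℝ) ∞ φ₁) (hφ₂ : ContMDiff I 𝓘(ℝ, ℝ) ∞ φ₂) :
    IsLeviCivita (weightedRiemannianMetric g hD hφ₁ hφ₂) (weightedConnection g hD φ₁ φ₂) :=
  ⟨weightedConnection_torsion hD, weightedConnection_isMetricConnection hD hgD hφ₁ hφ₂⟩

end TangentConn

end

/-- Differentiability of `Y` at `u` is required because the axioms of a covariant derivative do not
constrain its values on other fields; `X` enters only through its value at `u`. -/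
theorem theorem1p1 {E : Type*} [NormedAddCommGroup E] [NormedSpace ℝ E] [FiniteDimensional ℝ E]
    {M : Type*} [TopologicalSpace M] [T2Space M] [ChartedSpace E M] [IsManifold 𝓘(ℝ, E) ∞ M]
    (g : ContMDiffRiemannianMetric 𝓘(ℝ, E) ∞ E (TangentSpace 𝓘(ℝ, E) : M → Type _))
    (D : CovariantDerivative 𝓘(ℝ, E) E (TangentSpace 𝓘(ℝ, E) : M → Type _))
    (hD : D.ContMDiffCovariantDerivative ∞) (hgD : TangentConn.IsMetricConnection g D)
    (φ₁ φ₂ : M → ℝ) (hφ₁ : ContMDiff 𝓘(ℝ, E) 𝓘(ℝ, ℝ) ∞ φ₁) (hφ₂ : ContMDiff 𝓘(ℝ, E) 𝓘(ℝ, ℝ) ∞ φ₂) :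
    ∃ G : ContMDiffRiemannianMetric 𝓘(ℝ, E).tangent ∞ (E × E)
        (TangentSpace 𝓘(ℝ, E).tangent : TangentBundle 𝓘(ℝ, E) M → Type _),
      (∀ (u : TangentBundle 𝓘(ℝ, E) M) (X Y : TangentSpace 𝓘(ℝ, E).tangent u),
        G.inner u X Y = TangentConn.weightedMetric g D φ₁ φ₂ u X Y) ∧
      (∃ DG : CovariantDerivative 𝓘(ℝ, E).tangent (E × E)
          (TangentSpace 𝓘(ℝ, E).tangent : TangentBundle 𝓘(ℝ, E) M → Type _),
        DG.ContMDiffCovariantDerivative ∞ ∧ TangentConn.IsLeviCivita G DG) ∧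
      ∀ DG : CovariantDerivative 𝓘(ℝ, E).tangent (E × E)
          (TangentSpace 𝓘(ℝ, E).tangent : TangentBundle 𝓘(ℝ, E) M → Type _),
        TangentConn.IsLeviCivita G DG →
        ∀ (X Y : Π u : TangentBundle 𝓘(ℝ, E) M, TangentSpace 𝓘(ℝ, E).tangent u)
          (u : TangentBundle 𝓘(ℝ, E) M),
          MDifferentiableAt 𝓘(ℝ, E).tangent 𝓘(ℝ, E).tangent.tangent
            (fun w => (⟨w, Y w⟩ : TangentBundle 𝓘(ℝ, E).tangent (TangentBundle 𝓘(ℝ, E) M))) u →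
          DG Y u (X u) =
            TangentConn.Dstar g D φ₁ φ₂ u (X u) Y
              - (1 / 2 : ℝ) • TangentConn.Rcal D u (X u) (Y u)
              + TangentConn.tensorA g D φ₁ φ₂ u (X u) (Y u)
              + TangentConn.tensorB g D φ₁ φ₂ u (X u) (Y u)
              + TangentConn.tensorTau g D u (X u) (Y u) :=
  ⟨TangentConn.weightedRiemannianMetric g hD hφ₁ hφ₂, fun _ _ _ => rfl,
    ⟨TangentConn.weightedConnection g hD φ₁ φ₂,
      (TangentConn.weightedConnection_isLeviCivita hD hgD hφ₁ hφ₂).contMDiffCovariantDerivative,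
      TangentConn.weightedConnection_isLeviCivita hD hgD hφ₁ hφ₂⟩,
    fun _ hDG X _ u hY => hDG.eq_of_mdifferentiableAt
      (TangentConn.weightedConnection_isLeviCivita hD hgD hφ₁ hφ₂) hY (X u)⟩
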